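/- \textbf{Lemma (Exponential-energy operator under multimode squeezing).} Let $m\ge 1$ and let $a_1,\dots,a_m$ be the annihilation operators of $m$ bosonic modes, $|\bm n\rangle$ ($\bm n\in\mathbb N^m$) the Fock states, $|\bm n|=\sum_k n_k$, and $\hat N=\sum_k a_k^\dagger a_k$ the number operator, so that $\hat N|\bm n\rangle=|\bm n|\,|\bm n\rangle$. For $\bm r=(r_1,\dots,r_m)$ with all $r_k\ge 0$ let $\hat S(\bm r)=\exp\bigl(\tfrac12\sum_{k}r_k(a_k^2-a_k^{\dagger 2})\bigr)$ be the $m$-mode squeezing operator, and let $r=\max_k r_k$. Put \[ f(r,s)=1+\frac{s-1}{e^{2r}+\sinh r\,e^{r}(s-1)}, \] \[ g(r,s,t)=s\left(\frac{e^{2r}+\sinh r\,e^{r}(s-1)}{e^{-2r}-\sinh r\,e^{-r}(s-1)}\right)^{1/2}\frac{1}{(s-1)-(t-1)\bigl(e^{2r}+\sinh r\,e^{r}(s-1)\bigr)} . \] Let $|\psi\rangle=\sum_{\bm n}\psi_{\bm n}|\bm n\rangle$ be a normalized $m$-mode state such that $\langle\psi|s^{\hat N}|\psi\rangle=\sum_{\bm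 n}s^{|\bm n|}|\psi_{\bm n}|^2$ is finite. (1) If \[ 1<t<f(r,s)<s<\frac1{\tanh r}, \] then \[ \langle\psi|\hat S(\bm r)^\dagger\, t^{\hat N}\,\hat S(\bm r)|\psi\rangle< g(r,s,t)^m\,\langle\psi|s^{\hat N}|\psi\rangle . \] (2) If $r>0$ and $1<s<1/\tanh r$, then $t=1+\dfrac{s-1}{e^{2r}+1}$ satisfies $1<t<f(r,s)<s$, and for this $t$ \[ \langle\psi|\hat S(\bm r)^\dagger\, t^{\hat N}\,\hat S(\bm r)|\psi\rangle<\left(\frac{s}{s-1}\cdot\frac{(e^{2r}+1)^2}{\bigl(e^{-r}-\sinh r\,(s-1)\bigr)^2}\right)^{m}\langle\psi|s^{\hat N}|\psi\rangle . \] -/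

import Mathlib

namespace Bosonic

open Filter Topology

section
variable {E : Type*} [NormedAddCommGroup E] [InnerProductSpace ℂ E] [CompleteSpace E]

theorem norm_exp_smul_apply (A : E →L[ℂ] E) (hA : A ∈ skewAdjoint (E →L[ℂ] E)) (τ : ℝ) (x : E) :
    ‖NormedSpace.exp (τ • A) x‖ = ‖x‖ := by
  have h1 : τ • A ∈ skewAdjoint (E →L[ℂ] E) := skewAdjoint.smul_mem τ hA
  let _ : NormedAlgebra ℚ (E →L[ℂ] E) := NormedAlgebra.restrictScalars ℚ ℂ _
  have h2 := NormedSpace.exp_mem_unitary_of_mem_skewAdjoint h1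
  exact (Unitary.linearIsometryEquiv ⟨_, h2⟩).norm_map x

theorem hasDerivAt_exp_smul_apply (A : E →L[ℂ] E) (x : E) (τ : ℝ) :
    HasDerivAt (fun u : ℝ => NormedSpace.exp (u • A) x) (NormedSpace.exp (τ • A) (A x)) τ := by
  have h := hasDerivAt_exp_smul_const (𝕂 := ℝ) A τ
  have h3 := ((ContinuousLinearMap.apply ℂ E x).restrictScalars ℝ).hasFDerivAt.comp_hasDerivAt τ h
  exact h3

theorem hasDerivAt_exp_smul_apply' (A : E →L[ℂ] E) (x : E) (τ : ℝ) :
    HasDerivAt (fun u : ℝ => NormedSpace.exp (u • A) x) (A (NormedSpace.exp (τ • A) x)) τ := by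
  have h := hasDerivAt_exp_smul_const' (𝕂 := ℝ) A τ
  have h3 := ((ContinuousLinearMap.apply ℂ E x).restrictScalars ℝ).hasFDerivAt.comp_hasDerivAt τ h
  exact h3

theorem exp_add_smul_apply (A : E →L[ℂ] E) (σ τ : ℝ) (x : E) :
    NormedSpace.exp ((σ + τ) • A) x = NormedSpace.exp (σ • A) (NormedSpace.exp (τ • A) x) := by
  let _ : NormedAlgebra ℚ (E →L[ℂ] E) := NormedAlgebra.restrictScalars ℚ ℂ _
  rw [add_smul, NormedSpace.exp_add_of_commute (((Commute.refl A).smul_left σ).smul_right τ)]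
  rfl

theorem norm_exp_smul_sub_le (A : E →L[ℂ] E) (hA : A ∈ skewAdjoint (E →L[ℂ] E)) (τ : ℝ) (x : E) :
    ‖NormedSpace.exp (τ • A) x - x‖ ≤ ‖A x‖ * |τ| := by
  have h := convex_univ.norm_image_sub_le_of_norm_hasDerivWithin_le
    (f := fun u : ℝ => NormedSpace.exp (u • A) x) (C := ‖A x‖) (x := 0) (y := τ)
    (fun u _ => (hasDerivAt_exp_smul_apply A x u).hasDerivWithinAt)
    (fun u _ => (norm_exp_smul_apply A hA u _).le) (Set.mem_univ _) (Set.mem_univ _)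
  simpa using h

theorem norm_exp_smul_sub_sub_le (A : E →L[ℂ] E) (hA : A ∈ skewAdjoint (E →L[ℂ] E)) (τ : ℝ)
    (x : E) : ‖NormedSpace.exp (τ • A) x - x - τ • A x‖ ≤ ‖A (A x)‖ * |τ| * |τ| := by
  have h := (convex_closedBall (0 : ℝ) |τ|).norm_image_sub_le_of_norm_hasDerivWithin_le
    (f := fun u : ℝ => NormedSpace.exp (u • A) x - u • A x) (C := ‖A (A x)‖ * |τ|)
    (f' := fun u => NormedSpace.exp (u • A) (A x) - (1 : ℝ) • A x) (x := 0) (y := τ)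
    (fun u _ => ((hasDerivAt_exp_smul_apply A x u).sub
      ((hasDerivAt_id u).smul_const (A x))).hasDerivWithinAt)
    (fun u hu => by
      rw [one_smul]
      refine (norm_exp_smul_sub_le A hA u _).trans ?_
      have : |u| ≤ |τ| := by simpa using hu
      gcongr)
    (by simp) (by simp)
  have e : NormedSpace.exp (τ • A) x - x - τ • A x
      = NormedSpace.exp (τ • A) x - τ • A x - (NormedSpace.exp ((0:ℝ) • A) x - (0:ℝ) • A x) := by
    simp; abel
  rw [e]; simpa using h

theorem exists_unitaryGroup_of_cauchySeq (A : ℕ → E →L[ℂ] E)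
    (hA : ∀ K, A K ∈ skewAdjoint (E →L[ℂ] E)) (B : Set E)
    (hB : Dense (Submodule.span ℂ B : Set E))
    (hc : ∀ φ ∈ B, ∀ τ : ℝ, CauchySeq fun K => NormedSpace.exp (τ • A K) φ)
    (hev : ∀ φ ∈ B, ∃ χ, ∀ᶠ K in atTop, A K φ = χ) :
    ∃ U : ℝ → (E ≃ₗᵢ[ℂ] E), (∀ σ τ, U (σ + τ) = (U τ).trans (U σ)) ∧
      (∀ ψ, Continuous fun τ => U τ ψ) ∧
      ∀ φ χ χ', (∀ᶠ K in atTop, A K φ = χ) → (∀ᶠ K in atTop, A K χ = χ') →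
        HasDerivAt (fun τ => U τ φ) χ 0 := by
  -- convergence on the span, then everywhere
  have hc1 : ∀ φ ∈ Submodule.span ℂ B, ∀ τ : ℝ,
      CauchySeq fun K => NormedSpace.exp (τ • A K) φ := by
    intro φ hφ τ
    induction hφ using Submodule.span_induction with
    | mem x hx => exact hc x hx τ
    | zero => simpa using cauchySeq_const (0 : E)
    | add x y _ _ hx hy => simp only [map_add]; exact hx.add hy
    | smul a x _ hx =>
      simp only [map_smul]; exact (uniformContinuous_const_smul a).comp_cauchySeq hx
  have hc2 : ∀ φ : E, ∀ τ : ℝ, CauchySeq fun K => NormedSpace.exp (τ • A K) φ := by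
    intro φ τ
    rw [Metric.cauchySeq_iff']
    intro ε hε
    obtain ⟨φ', hφ', hd⟩ := hB.exists_dist_lt φ (ε := ε / 3) (by positivity)
    obtain ⟨N, hN⟩ := Metric.cauchySeq_iff'.1 (hc1 φ' hφ' τ) (ε / 3) (by positivity)
    refine ⟨N, fun n hn => ?_⟩
    have k : ∀ K, dist (NormedSpace.exp (τ • A K) φ) (NormedSpace.exp (τ • A K) φ') < ε / 3 := by
      intro K
      rw [dist_eq_norm, ← map_sub, norm_exp_smul_apply _ (hA K), ← dist_eq_norm]; exact hd
    have k1 := k n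
    have k2 := k N
    have k3 := hN n hn
    rw [dist_comm] at k2
    calc _ ≤ _ := dist_triangle4 _ (NormedSpace.exp (τ • A n) φ') (NormedSpace.exp (τ • A N) φ') _
      _ < ε := by linarith
  choose V hV using fun (τ : ℝ) (φ : E) => cauchySeq_tendsto_of_complete (hc2 φ τ)
  have hVn : ∀ τ φ, ‖V τ φ‖ = ‖φ‖ := fun τ φ =>
    tendsto_nhds_unique (hV τ φ).norm (by simp [norm_exp_smul_apply _ (hA _)])
  have hVadd : ∀ τ x y, V τ (x + y) = V τ x + V τ y := fun τ x y =>
    tendsto_nhds_unique (hV τ (x + y)) (by simpa using (hV τ x).add (hV τ y))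
  have hVsmul : ∀ τ (c : ℂ) x, V τ (c • x) = c • V τ x := fun τ c x =>
    tendsto_nhds_unique (hV τ (c • x)) (by simpa using (hV τ x).const_smul c)
  have hV0 : ∀ x, V 0 x = x := fun x =>
    tendsto_nhds_unique (hV 0 x) (by simp)
  have hVsub : ∀ τ x y, V τ (x - y) = V τ x - V τ y := fun τ x y =>
    tendsto_nhds_unique (hV τ (x - y)) (by simpa using (hV τ x).sub (hV τ y))
  have hVgrp : ∀ σ τ x, V (σ + τ) x = V σ (V τ x) := by
    intro σ τ x
    refine tendsto_nhds_unique (hV (σ + τ) x) ?_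
    simp_rw [exp_add_smul_apply]
    have h1 := hV σ (V τ x)
    have h2 : Tendsto (fun K => NormedSpace.exp (σ • A K)
        (NormedSpace.exp (τ • A K) x - V τ x)) atTop (𝓝 0) := by
      rw [tendsto_zero_iff_norm_tendsto_zero]
      simp_rw [norm_exp_smul_apply _ (hA _)]
      exact tendsto_iff_norm_sub_tendsto_zero.1 (hV τ x)
    simpa using h2.add h1
  let U : ℝ → (E ≃ₗᵢ[ℂ] E) := fun τ =>
    { toFun := V τ
      map_add' := hVadd τ
      map_smul' := hVsmul τ
      invFun := V (-τ)
      left_inv := fun x => by rw [← hVgrp, neg_add_cancel, hV0]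
      right_inv := fun x => by rw [← hVgrp, add_neg_cancel, hV0]
      norm_map' := hVn τ }
  have hU : ∀ τ x, U τ x = V τ x := fun _ _ => rfl
  have hlip : ∀ φ χ, (∀ᶠ K in atTop, A K φ = χ) → ∀ τ, ‖V τ φ - φ‖ ≤ ‖χ‖ * |τ| := by
    intro φ χ h τ
    refine le_of_tendsto ((hV τ φ).sub_const φ).norm ?_
    filter_upwards [h] with K hK
    rw [← hK]; exact norm_exp_smul_sub_le _ (hA K) _ _
  have hcont0 : ∀ ψ, Tendsto (fun τ => V τ ψ) (𝓝 0) (𝓝 ψ) := by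
    intro ψ
    have hs : ∀ φ ∈ Submodule.span ℂ B, Tendsto (fun τ => V τ φ) (𝓝 0) (𝓝 φ) := by
      intro φ hφ
      induction hφ using Submodule.span_induction with
      | mem x hx =>
        obtain ⟨χ, hχ⟩ := hev x hx
        rw [tendsto_iff_norm_sub_tendsto_zero]
        refine squeeze_zero (fun _ => norm_nonneg _) (hlip x χ hχ) ?_
        have : Continuous fun τ : ℝ => ‖χ‖ * |τ| := by fun_prop
        simpa using this.tendsto 0
      | zero =>
        have : ∀ τ, V τ 0 = 0 := fun τ => by rw [← norm_eq_zero, hVn, norm_zero]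
        simp [this]
      | add x y _ _ hx hy => simpa [hVadd] using hx.add hy
      | smul a x _ hx => simpa [hVsmul] using hx.const_smul a
    rw [Metric.tendsto_nhds]
    intro ε hε
    obtain ⟨φ, hφ, hd⟩ := hB.exists_dist_lt ψ (ε := ε / 3) (by positivity)
    filter_upwards [Metric.tendsto_nhds.1 (hs φ hφ) (ε / 3) (by positivity)] with τ hτ
    have k : dist (V τ ψ) (V τ φ) < ε / 3 := by
      rw [dist_eq_norm, ← hVsub, hVn, ← dist_eq_norm]; exact hd
    rw [dist_comm] at hd
    calc _ ≤ _ := dist_triangle4 _ (V τ φ) φ _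
      _ < ε := by linarith
  refine ⟨U, fun σ τ => ?_, fun ψ => ?_, fun φ χ χ' h1 h2 => ?_⟩
  · ext x; exact hVgrp σ τ x
  · rw [continuous_iff_continuousAt]
    intro τ
    have h := hcont0 (V τ ψ)
    have h2 : Tendsto (fun u => u - τ) (𝓝 τ) (𝓝 0) := by
      have : Continuous fun u : ℝ => u - τ := by fun_prop
      simpa using this.tendsto τ
    have h3 := h.comp h2
    refine h3.congr fun u => ?_
    simp only [Function.comp, ← hVgrp, sub_add_cancel]; rfl
  · have hb : ∀ τ, ‖V τ φ - φ - τ • χ‖ ≤ ‖χ'‖ * |τ| * |τ| := by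
      intro τ
      refine le_of_tendsto (((hV τ φ).sub_const φ).sub_const (τ • χ)).norm ?_
      filter_upwards [h1, h2] with K hK hK'
      have := norm_exp_smul_sub_sub_le _ (hA K) τ φ
      rwa [hK, hK'] at this
    rw [hasDerivAt_iff_isLittleO_nhds_zero]
    simp only [hU, hV0, zero_add]
    refine Asymptotics.IsBigO.trans_isLittleO
      (Asymptotics.IsBigO.of_bound ‖χ'‖ (Eventually.of_forall fun τ => ?_))
      (g := fun τ : ℝ => τ ^ 2) ?_
    · have := hb τ
      simpa [sq, mul_assoc] using this
    · have := Asymptotics.isLittleO_pow_id (𝕜 := ℝ) (n := 2) (by norm_num)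
      exact this
end

section
variable {ι : Type*} [DecidableEq ι]

/-- The bounded operator on `ℓ²(ι)` whose matrix is the restriction of `g` to `F × F`. -/
noncomputable def compressedMatrixOp (g : ι → ι → ℝ) (F : Finset ι) :
    lp (fun _ : ι => ℂ) 2 →L[ℂ] lp (fun _ : ι => ℂ) 2 :=
  ∑ p ∈ F, ∑ n ∈ F, (g p n : ℂ) •
    InnerProductSpace.rankOne ℂ (lp.single 2 p (1 : ℂ)) (lp.single 2 n (1 : ℂ))

theorem compressedMatrixOp_eq (g : ι → ι → ℝ) (F : Finset ι) (x : lp (fun _ : ι => ℂ) 2) :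
    compressedMatrixOp g F x
      = ∑ p ∈ F, (∑ n ∈ F, (g p n : ℂ) * x n) • lp.single (E := fun _ : ι => ℂ) 2 p (1 : ℂ) := by
  simp only [compressedMatrixOp, _root_.sum_apply, _root_.smul_apply, Finset.sum_smul,
    InnerProductSpace.rankOne_apply, lp.inner_single_left, smul_smul]
  simp

theorem compressedMatrixOp_apply (g : ι → ι → ℝ) (F : Finset ι) (x : lp (fun _ : ι => ℂ) 2)
    (p : ι) : compressedMatrixOp g F x p = if p ∈ F then ∑ n ∈ F, (g p n : ℂ) * x n else 0 := by
  rw [compressedMatrixOp_eq, lp.coeFn_sum, Finset.sum_apply]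
  simp [lp.single_apply, Pi.single_apply]

theorem compressedMatrixOp_mem_skewAdjoint (g : ι → ι → ℝ) (hg : ∀ p n, g p n = -g n p)
    (F : Finset ι) : compressedMatrixOp g F ∈ skewAdjoint _ := by
  rw [skewAdjoint.mem_iff, compressedMatrixOp]
  simp only [star_sum, star_smul, ContinuousLinearMap.star_eq_adjoint,
    InnerProductSpace.adjoint_rankOne]
  rw [Finset.sum_comm, ← Finset.sum_neg_distrib]
  refine Finset.sum_congr rfl fun p _ => ?_
  rw [← Finset.sum_neg_distrib]
  refine Finset.sum_congr rfl fun n _ => ?_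
  rw [hg p n]; simp

/-- The orbit of a basis vector under the compressed group. -/
noncomputable def compressedOrbit (g : ι → ι → ℝ) (F : Finset ι) (a : ι) (τ : ℝ) :
    lp (fun _ : ι => ℂ) 2 :=
  NormedSpace.exp (τ • compressedMatrixOp g F) (lp.single 2 a (1 : ℂ))

theorem hasDerivAt_compressedOrbit (g : ι → ι → ℝ) (F : Finset ι) (a : ι) (τ : ℝ) :
    HasDerivAt (compressedOrbit g F a)
      (compressedMatrixOp g F (compressedOrbit g F a τ)) τ :=
  hasDerivAt_exp_smul_apply' _ _ _

theorem hasDerivAt_compressedOrbit_apply (g : ι → ι → ℝ) (F : Finset ι) (a : ι) (p : ι) (τ : ℝ) :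
    HasDerivAt (fun u => compressedOrbit g F a u p)
      (if p ∈ F then ∑ n ∈ F, (g p n : ℂ) * compressedOrbit g F a τ n else 0) τ := by
  have h := hasDerivAt_compressedOrbit g F a τ
  have h3 := ((innerSL ℂ (lp.single (E := fun _ : ι => ℂ) 2 p (1 : ℂ))).restrictScalars
    ℝ).hasFDerivAt.comp_hasDerivAt τ h
  rw [← compressedMatrixOp_apply]
  simpa [Function.comp_def, lp.inner_single_left] using h3

theorem compressedOrbit_apply_of_notMem (g : ι → ι → ℝ) (F : Finset ι) (a : ι) (ha : a ∈ F)
    (p : ι) (hp : p ∉ F) (τ : ℝ) : compressedOrbit g F a τ p = 0 := by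
  have h : ∀ u, HasDerivAt (fun u => compressedOrbit g F a u p) 0 u := fun u => by
    simpa [hp] using hasDerivAt_compressedOrbit_apply g F a p u
  have h2 := is_const_of_deriv_eq_zero (fun u => (h u).differentiableAt)
    (fun u => (h u).deriv) τ 0
  rw [h2]
  have : p ≠ a := fun h => hp (h ▸ ha)
  simp [compressedOrbit, this]

/-- A weighted energy estimate, uniform in the truncation. -/
theorem weighted_compressedOrbit_le (g : ι → ι → ℝ) (hg : ∀ p n, g p n = -g n p)
    (F : Finset ι) (a : ι) (ha : a ∈ F) (w : ι → ℝ) (hw : ∀ p, 0 ≤ w p) (C : ℝ)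
    (hC : ∀ p, ∑ n ∈ F, |g p n| * |w p - w n| ≤ C * w p) (τ : ℝ) (hτ : 0 ≤ τ) :
    ∑ p ∈ F, w p * ‖compressedOrbit g F a τ p‖ ^ 2 ≤ w a * Real.exp (C * τ) := by
  set x := compressedOrbit g F a with hx
  have hd : ∀ u, HasDerivAt (fun u => ∑ p ∈ F, w p * ‖x u p‖ ^ 2)
      (∑ p ∈ F, w p * (2 * inner ℝ (x u p) (∑ n ∈ F, (g p n : ℂ) * x u n))) u := by
    intro u
    refine HasDerivAt.fun_sum fun p hp => ?_
    have := hasDerivAt_compressedOrbit_apply g F a p u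
    rw [if_pos hp] at this
    exact this.norm_sq.const_mul _
  have hval : ∀ u, ∑ p ∈ F, w p * (2 * inner ℝ (x u p) (∑ n ∈ F, (g p n : ℂ) * x u n))
      = ∑ p ∈ F, ∑ n ∈ F, g p n * (w p - w n) * inner ℝ (x u p) (x u n) := by
    intro u
    have e1 : ∑ p ∈ F, w p * (2 * inner ℝ (x u p) (∑ n ∈ F, (g p n : ℂ) * x u n))
        = ∑ p ∈ F, ∑ n ∈ F, 2 * (w p * g p n * inner ℝ (x u p) (x u n)) := by
      refine Finset.sum_congr rfl fun p _ => ?_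
      rw [inner_sum, Finset.mul_sum, Finset.mul_sum]
      refine Finset.sum_congr rfl fun n _ => ?_
      rw [← Complex.real_smul, inner_smul_right]; ring
    have e2 : ∑ p ∈ F, ∑ n ∈ F, w p * g p n * inner ℝ (x u p) (x u n)
        = ∑ p ∈ F, ∑ n ∈ F, - (w n * g p n * inner ℝ (x u p) (x u n)) := by
      rw [Finset.sum_comm]
      refine Finset.sum_congr rfl fun p _ => Finset.sum_congr rfl fun n _ => ?_
      rw [hg n p, real_inner_comm]; ring
    rw [e1]
    simp_rw [← Finset.mul_sum]
    rw [two_mul]; nth_rewrite 2 [e2]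
    rw [← Finset.sum_add_distrib]
    refine Finset.sum_congr rfl fun p _ => ?_
    rw [← Finset.sum_add_distrib]
    exact Finset.sum_congr rfl fun n _ => by ring
  have hnn : ∀ u, 0 ≤ ∑ p ∈ F, w p * ‖x u p‖ ^ 2 := fun u =>
    Finset.sum_nonneg fun p _ => mul_nonneg (hw p) (sq_nonneg _)
  have hbd : ∀ u, ‖∑ p ∈ F, ∑ n ∈ F, g p n * (w p - w n) * inner ℝ (x u p) (x u n)‖
      ≤ C * ‖∑ p ∈ F, w p * ‖x u p‖ ^ 2‖ + 0 := by
    intro u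
    rw [add_zero, Real.norm_of_nonneg (hnn u)]
    have key : ∀ p n, ‖g p n * (w p - w n) * inner ℝ (x u p) (x u n)‖
        ≤ |g p n| * |w p - w n| * ‖x u p‖ ^ 2 / 2 + |g p n| * |w p - w n| * ‖x u n‖ ^ 2 / 2 := by
      intro p n
      rw [norm_mul, norm_mul, Real.norm_eq_abs, Real.norm_eq_abs]
      have h1 : ‖inner ℝ (x u p) (x u n)‖ ≤ (‖x u p‖ ^ 2 + ‖x u n‖ ^ 2) / 2 := by
        refine (norm_inner_le_norm _ _).trans ?_
        nlinarith [sq_nonneg (‖x u p‖ - ‖x u n‖)]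
      have h2 := mul_le_mul_of_nonneg_left h1
        (mul_nonneg (abs_nonneg (g p n)) (abs_nonneg (w p - w n)))
      linarith
    calc _ ≤ ∑ p ∈ F, ∑ n ∈ F, ‖g p n * (w p - w n) * inner ℝ (x u p) (x u n)‖ :=
          (norm_sum_le _ _).trans (Finset.sum_le_sum fun p _ => norm_sum_le _ _)
      _ ≤ ∑ p ∈ F, ∑ n ∈ F, (|g p n| * |w p - w n| * ‖x u p‖ ^ 2 / 2
            + |g p n| * |w p - w n| * ‖x u n‖ ^ 2 / 2) :=
          Finset.sum_le_sum fun p _ => Finset.sum_le_sum fun n _ => key p n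
      _ = ∑ p ∈ F, ∑ n ∈ F, |g p n| * |w p - w n| * ‖x u p‖ ^ 2 := by
          simp_rw [Finset.sum_add_distrib]
          have : ∑ p ∈ F, ∑ n ∈ F, |g p n| * |w p - w n| * ‖x u n‖ ^ 2 / 2
              = ∑ p ∈ F, ∑ n ∈ F, |g p n| * |w p - w n| * ‖x u p‖ ^ 2 / 2 := by
            rw [Finset.sum_comm]
            refine Finset.sum_congr rfl fun p _ => Finset.sum_congr rfl fun n _ => ?_
            rw [hg n p, abs_neg, abs_sub_comm]
          rw [this, ← Finset.sum_add_distrib]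
          refine Finset.sum_congr rfl fun p _ => ?_
          rw [← Finset.sum_add_distrib]
          exact Finset.sum_congr rfl fun n _ => by ring
      _ ≤ ∑ p ∈ F, C * w p * ‖x u p‖ ^ 2 := by
          refine Finset.sum_le_sum fun p _ => ?_
          rw [← Finset.sum_mul]
          exact mul_le_mul_of_nonneg_right (hC p) (sq_nonneg _)
      _ = _ := by rw [Finset.mul_sum]; exact Finset.sum_congr rfl fun p _ => by ring
  have h0 : ∑ p ∈ F, w p * ‖x 0 p‖ ^ 2 = w a := by
    have : ∀ p, w p * ‖x 0 p‖ ^ 2 = if p = a then w a else 0 := by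
      intro p
      by_cases h : p = a
      · subst h; simp [hx, compressedOrbit]
      · simp [hx, compressedOrbit, h]
    simp_rw [this]; simp [ha]
  have G := norm_le_gronwallBound_of_norm_deriv_right_le
    (f := fun u => ∑ p ∈ F, w p * ‖x u p‖ ^ 2) (δ := w a) (K := C) (ε := 0) (a := 0) (b := τ)
    (fun u _ => (hd u).continuousAt.continuousWithinAt)
    (fun u _ => (hd u).hasDerivWithinAt)
    (by rw [h0, Real.norm_of_nonneg (hw a)])
    (fun u _ => by rw [hval]; exact hbd u) τ ⟨hτ, le_rfl⟩
  rw [gronwallBound_ε0, sub_zero, Real.norm_of_nonneg (hnn τ)] at G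
  exact G

theorem cauchySeq_exp_compressedMatrixOp_of_nonneg (g : ι → ι → ℝ) (hg : ∀ p n, g p n = -g n p)
    (N : ι → ℕ) (F : ℕ → Finset ι) (hF : ∀ K p, p ∈ F K ↔ N p ≤ K)
    (hband : ∀ p n, g p n ≠ 0 → N p ≤ N n + 2) (C : ℝ) (hC0 : 0 ≤ C)
    (hrow : ∀ (S : Finset ι) (p : ι), ∑ n ∈ S, |g p n| ≤ C * (N p + 1)) (a : ι)
    (τ : ℝ) (hτ : 0 ≤ τ) :
    CauchySeq fun K => compressedOrbit g (F K) a τ := by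
  set w : ι → ℝ := fun p => ((N p : ℝ) + 1) ^ 2 with hw
  have hw0 : ∀ p, 0 ≤ w p := fun p => sq_nonneg _
  -- uniform second moment bound
  have hwd : ∀ p n, |g p n| * |w p - w n| ≤ |g p n| * (8 * (N p + 1)) := by
    intro p n
    by_cases h : g p n = 0
    · simp [h]
    have h1 := hband p n h
    have h2 := hband n p (by rw [hg]; simpa using h)
    have h1' : (N p : ℝ) ≤ N n + 2 := by exact_mod_cast h1
    have h2' : (N n : ℝ) ≤ N p + 2 := by exact_mod_cast h2
    have hp : (0 : ℝ) ≤ N p := Nat.cast_nonneg _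
    have hn : (0 : ℝ) ≤ N n := Nat.cast_nonneg _
    refine mul_le_mul_of_nonneg_left ?_ (abs_nonneg _)
    rw [hw, abs_le]
    constructor <;> nlinarith
  have hCw : ∀ K p, ∑ n ∈ F K, |g p n| * |w p - w n| ≤ (8 * C) * w p := by
    intro K p
    calc _ ≤ ∑ n ∈ F K, |g p n| * (8 * (N p + 1)) := Finset.sum_le_sum fun n _ => hwd p n
      _ = (∑ n ∈ F K, |g p n|) * (8 * (N p + 1)) := by rw [Finset.sum_mul]
      _ ≤ C * (N p + 1) * (8 * (N p + 1)) :=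
          mul_le_mul_of_nonneg_right (hrow _ _) (by positivity)
      _ = _ := by rw [hw]; ring
  have hV : ∀ K, N a ≤ K → ∀ u, 0 ≤ u → u ≤ τ →
      ∑ p ∈ F K, w p * ‖compressedOrbit g (F K) a u p‖ ^ 2 ≤ w a * Real.exp (8 * C * τ) := by
    intro K hK u hu huτ
    refine (weighted_compressedOrbit_le g hg (F K) a ((hF _ _).2 hK) w hw0 (8 * C) (hCw K) u
      hu).trans ?_
    have : 8 * C * u ≤ 8 * C * τ := by gcongr
    have := Real.exp_le_exp.2 this
    exact mul_le_mul_of_nonneg_left this (hw0 a)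
  set M := w a * Real.exp (8 * C * τ) with hM
  have hM0 : 0 ≤ M := mul_nonneg (hw0 a) (Real.exp_pos _).le
  -- comparison of two truncations
  have hcmp : ∀ K L, N a ≤ K → 1 ≤ K → K ≤ L →
      ‖compressedOrbit g (F L) a τ - compressedOrbit g (F K) a τ‖ ^ 2
        ≤ 2 * (C * M / K) * τ := by
    intro K L haK hK1 hKL
    have hK0 : (0 : ℝ) < K := by exact_mod_cast hK1
    set x := compressedOrbit g (F L) a with hx
    set y := compressedOrbit g (F K) a with hy
    have hsub : F K ⊆ F L := fun p hp => (hF _ _).2 (((hF _ _).1 hp).trans hKL)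
    have hyz : ∀ u n, n ∉ F K → y u n = 0 := fun u n hn =>
      compressedOrbit_apply_of_notMem g (F K) a ((hF _ _).2 haK) n hn u
    set A := compressedMatrixOp g (F L) with hA
    set B := compressedMatrixOp g (F K) with hB
    have skew : ∀ (G : Finset ι) (z : lp (fun _ : ι => ℂ) 2),
        (inner ℂ z (compressedMatrixOp g G z)).re = 0 := by
      intro G z
      have h := compressedMatrixOp_mem_skewAdjoint g hg G
      rw [skewAdjoint.mem_iff, ContinuousLinearMap.star_eq_adjoint] at h
      have h1 := ContinuousLinearMap.adjoint_inner_right (compressedMatrixOp g G) z z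
      rw [h, _root_.neg_apply, inner_neg_right] at h1
      have h2 := congrArg Complex.re h1
      rw [← inner_conj_symm (compressedMatrixOp g G z) z, Complex.neg_re, Complex.conj_re] at h2
      linarith
    have hd : ∀ u, HasDerivAt (fun u => ‖x u - y u‖ ^ 2)
        (2 * (inner ℂ (x u) ((A - B) (y u))).re) u := by
      intro u
      let _ : InnerProductSpace ℝ (lp (fun _ : ι => ℂ) 2) := InnerProductSpace.rclikeToReal ℂ _
      have h1 := ((hasDerivAt_compressedOrbit g (F L) a u).sub
        (hasDerivAt_compressedOrbit g (F K) a u)).norm_sq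
      refine h1.congr_deriv (Eq.symm ?_)
      change 2 * (inner ℂ (x u) ((A - B) (y u))).re
        = 2 * (inner ℂ (x u - y u) (A (x u) - B (y u))).re
      have e : A (x u) - B (y u) = A (x u - y u) + (A - B) (y u) := by
        simp
      have e1 := skew (F L) (x u - y u)
      have e2 := skew (F L) (y u)
      have e3 := skew (F K) (y u)
      rw [← hA] at e1 e2
      rw [← hB] at e3
      rw [e, inner_add_right, Complex.add_re, e1, zero_add, inner_sub_left, Complex.sub_re,
        _root_.sub_apply, inner_sub_right (y u), Complex.sub_re, e2, e3]
      ring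
    have hABy : ∀ u, (A - B) (y u) = ∑ p ∈ F L \ F K, (∑ n ∈ F K, (g p n : ℂ) * y u n) •
        lp.single (E := fun _ : ι => ℂ) 2 p (1 : ℂ) := by
      intro u
      have : ∀ p, ∑ n ∈ F L, (g p n : ℂ) * y u n = ∑ n ∈ F K, (g p n : ℂ) * y u n := by
        intro p
        refine (Finset.sum_subset hsub fun n _ hn => ?_).symm
        rw [hyz u n hn, mul_zero]
      rw [_root_.sub_apply, hA, hB, compressedMatrixOp_eq, compressedMatrixOp_eq]
      simp_rw [this]
      rw [← Finset.sum_sdiff hsub, add_sub_cancel_right]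
    have hbd : ∀ u, 0 ≤ u → u ≤ τ → ‖(inner ℂ (x u) ((A - B) (y u))).re‖ ≤ C * M / K := by
      intro u hu huτ
      have e : inner ℂ (x u) ((A - B) (y u)) = ∑ p ∈ F L \ F K, ∑ n ∈ F K,
          (g p n : ℂ) * (starRingEnd ℂ (x u p) * y u n) := by
        rw [hABy, inner_sum]
        refine Finset.sum_congr rfl fun p _ => ?_
        rw [inner_smul_right, lp.inner_single_right, Finset.sum_mul]
        refine Finset.sum_congr rfl fun n _ => ?_
        simp; ring
      have key : ∀ p n, ‖(g p n : ℂ) * (starRingEnd ℂ (x u p) * y u n)‖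
          ≤ |g p n| * (‖x u p‖ ^ 2 / 2) + |g p n| * (‖y u n‖ ^ 2 / 2) := by
        intro p n
        rw [norm_mul, norm_mul, RCLike.norm_conj, Complex.norm_real, Real.norm_eq_abs, ← mul_add]
        refine mul_le_mul_of_nonneg_left ?_ (abs_nonneg _)
        nlinarith [sq_nonneg (‖x u p‖ - ‖y u n‖)]
      have b1 : ∑ p ∈ F L \ F K, ∑ n ∈ F K, |g p n| * (‖x u p‖ ^ 2 / 2) ≤ C * M / K / 2 := by
        calc _ ≤ ∑ p ∈ F L \ F K, C / K * (w p * ‖x u p‖ ^ 2) / 2 := by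
              refine Finset.sum_le_sum fun p hp => ?_
              rw [← Finset.sum_mul]
              have hp' : K ≤ N p := by
                have := (Finset.mem_sdiff.1 hp).2
                rw [hF] at this; omega
              have hp'' : (K : ℝ) ≤ N p + 1 := by
                have : (K : ℝ) ≤ N p := by exact_mod_cast hp'
                linarith
              have h1 : C * (N p + 1) ≤ C / K * w p := by
                rw [hw, div_mul_eq_mul_div, le_div_iff₀ hK0]
                have : (N p + 1 : ℝ) * K ≤ (N p + 1) ^ 2 := by nlinarith
                nlinarith
              have := mul_le_mul_of_nonneg_right ((hrow (F K) p).trans h1)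
                (by positivity : 0 ≤ ‖x u p‖ ^ 2 / 2)
              linarith
          _ ≤ ∑ p ∈ F L, C / K * (w p * ‖x u p‖ ^ 2) / 2 := by
              refine Finset.sum_le_sum_of_subset_of_nonneg Finset.sdiff_subset fun p _ _ => ?_
              have := hw0 p
              positivity
          _ = C / K * (∑ p ∈ F L, w p * ‖x u p‖ ^ 2) / 2 := by
              rw [Finset.mul_sum, Finset.sum_div]
          _ ≤ C / K * M / 2 := by
              have := hV L (haK.trans hKL) u hu huτ
              gcongr
          _ = _ := by ring
      have b2 : ∑ p ∈ F L \ F K, ∑ n ∈ F K, |g p n| * (‖y u n‖ ^ 2 / 2) ≤ C * M / K / 2 := by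
        rw [Finset.sum_comm]
        calc _ ≤ ∑ n ∈ F K, C / K * (w n * ‖y u n‖ ^ 2) / 2 := by
              refine Finset.sum_le_sum fun n hn => ?_
              rw [← Finset.sum_mul]
              have h1 : ∑ p ∈ F L \ F K, |g p n| ≤ C / K * w n := by
                by_cases hn' : N n + 2 ≤ K
                · have : ∑ p ∈ F L \ F K, |g p n| = 0 := by
                    refine Finset.sum_eq_zero fun p hp => ?_
                    by_contra h
                    have h3 := hband p n (fun h0 => h (by rw [h0, abs_zero]))
                    have := (Finset.mem_sdiff.1 hp).2
                    rw [hF] at this; omega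
                  rw [this]
                  have := hw0 n
                  positivity
                · have h2 : ∑ p ∈ F L \ F K, |g p n| ≤ C * (N n + 1) := by
                    have : ∀ p, |g p n| = |g n p| := fun p => by rw [hg p n, abs_neg]
                    simp_rw [this]; exact hrow _ n
                  refine h2.trans ?_
                  have hn'' : (K : ℝ) ≤ N n + 1 := by
                    have : K ≤ N n + 1 := by omega
                    exact_mod_cast this
                  rw [hw, div_mul_eq_mul_div, le_div_iff₀ hK0]
                  have : (N n + 1 : ℝ) * K ≤ (N n + 1) ^ 2 := by nlinarith
                  nlinarith
              have := mul_le_mul_of_nonneg_right h1 (by positivity : 0 ≤ ‖y u n‖ ^ 2 / 2)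
              linarith
          _ = C / K * (∑ n ∈ F K, w n * ‖y u n‖ ^ 2) / 2 := by
              rw [Finset.mul_sum, Finset.sum_div]
          _ ≤ C / K * M / 2 := by
              have := hV K haK u hu huτ
              gcongr
          _ = _ := by ring
      rw [Real.norm_eq_abs]
      refine (Complex.abs_re_le_norm _).trans ?_
      rw [e]
      calc _ ≤ ∑ p ∈ F L \ F K, ∑ n ∈ F K, ‖(g p n : ℂ) * (starRingEnd ℂ (x u p) * y u n)‖ :=
            (norm_sum_le _ _).trans (Finset.sum_le_sum fun p _ => norm_sum_le _ _)
        _ ≤ ∑ p ∈ F L \ F K, ∑ n ∈ F K,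
              (|g p n| * (‖x u p‖ ^ 2 / 2) + |g p n| * (‖y u n‖ ^ 2 / 2)) :=
            Finset.sum_le_sum fun p _ => Finset.sum_le_sum fun n _ => key p n
        _ ≤ _ := by
            simp_rw [Finset.sum_add_distrib]
            linarith
    have h := (convex_Icc (0 : ℝ) τ).norm_image_sub_le_of_norm_hasDerivWithin_le
      (f := fun u => ‖x u - y u‖ ^ 2) (C := 2 * (C * M / K)) (x := 0) (y := τ)
      (fun u _ => (hd u).hasDerivWithinAt)
      (fun u hu => by
        rw [norm_mul, Real.norm_ofNat]
        exact mul_le_mul_of_nonneg_left (hbd u hu.1 hu.2) (by norm_num))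
      ⟨le_rfl, hτ⟩ ⟨hτ, le_rfl⟩
    have h00 : x 0 - y 0 = 0 := by simp [hx, hy, compressedOrbit]
    simp only [h00, norm_zero, sub_zero] at h
    rw [Real.norm_of_nonneg hτ] at h
    refine le_trans (le_of_eq ?_) h
    simp
  -- conclusion
  rw [Metric.cauchySeq_iff']
  intro ε hε
  obtain ⟨K, hK⟩ := exists_nat_gt (max (max (N a : ℝ) 1) (2 * C * M * τ / ε ^ 2))
  have hKa : N a ≤ K := by
    have := ((le_max_left _ _).trans (le_max_left _ _)).trans hK.le
    exact_mod_cast this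
  have hK1 : 1 ≤ K := by
    have := ((le_max_right _ _).trans (le_max_left _ _)).trans hK.le
    exact_mod_cast this
  have hK2 : 2 * C * M * τ / ε ^ 2 < K := (le_max_right _ _).trans_lt hK
  refine ⟨K, fun L hL => ?_⟩
  have hK0 : (0 : ℝ) < K := by exact_mod_cast hK1
  have h := hcmp K L hKa hK1 hL
  rw [dist_eq_norm]
  refine lt_of_pow_lt_pow_left₀ 2 hε.le (h.trans_lt ?_)
  rw [div_lt_iff₀ (by positivity)] at hK2
  have : 2 * (C * M / K) * τ = 2 * C * M * τ / K := by ring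
  rw [this, div_lt_iff₀ hK0]
  linarith

theorem cauchySeq_exp_compressedMatrixOp (g : ι → ι → ℝ) (hg : ∀ p n, g p n = -g n p)
    (N : ι → ℕ) (F : ℕ → Finset ι) (hF : ∀ K p, p ∈ F K ↔ N p ≤ K)
    (hband : ∀ p n, g p n ≠ 0 → N p ≤ N n + 2) (C : ℝ) (hC0 : 0 ≤ C)
    (hrow : ∀ (S : Finset ι) (p : ι), ∑ n ∈ S, |g p n| ≤ C * (N p + 1)) (a : ι) (τ : ℝ) :
    CauchySeq fun K => compressedOrbit g (F K) a τ := by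
  rcases le_total 0 τ with h | h
  · exact cauchySeq_exp_compressedMatrixOp_of_nonneg g hg N F hF hband C hC0 hrow a τ h
  · have h1 := cauchySeq_exp_compressedMatrixOp_of_nonneg (fun p n => -g p n)
      (fun p n => by rw [hg p n]) N F hF (fun p n h => hband p n (by simpa using h)) C hC0
      (by simpa using hrow) a (-τ) (by linarith)
    have e : ∀ K, compressedOrbit (fun p n => -g p n) (F K) a (-τ)
        = compressedOrbit g (F K) a τ := by
      intro K
      have : compressedMatrixOp (fun p n => -g p n) (F K) = - compressedMatrixOp g (F K) := by
        simp [compressedMatrixOp, Finset.sum_neg_distrib]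
      rw [compressedOrbit, this, smul_neg, neg_smul, neg_neg]; rfl
    simpa only [e] using h1
end

/-- The Hilbert space of `m` bosonic modes, `ℓ²(ℕ^m)`, in the Fock representation: the vector
`ψ = ∑ₙ ψₙ |n⟩` is given by its family of Fock amplitudes `n ↦ ψₙ`. -/
abbrev FockSpace (m : ℕ) : Type := lp (fun _ : Fin m → ℕ => ℂ) 2

/-- The algebraic span of the Fock states: finite linear combinations `∑ₙ φₙ |n⟩`. It is the domain
on which the ladder operators and their polynomials act. -/
abbrev FiniteFock (m : ℕ) : Type := (Fin m → ℕ) →₀ ℂ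

/-- The Fock state `|n⟩`. -/
noncomputable def fockState {m : ℕ} (n : Fin m → ℕ) : FockSpace m := lp.single 2 n (1 : ℂ)

/-- The inclusion of the algebraic span of the Fock states in the Hilbert space. -/
noncomputable def toFockSpace {m : ℕ} : FiniteFock m →ₗ[ℂ] FockSpace m :=
  Finsupp.linearCombination ℂ fockState

/-- The annihilation operator `a_k` of mode `k`: `a_k |n⟩ = √n_k |n - e_k⟩`. -/
noncomputable def annihilation {m : ℕ} (k : Fin m) : FiniteFock m →ₗ[ℂ] FiniteFock m :=
  Finsupp.linearCombination ℂ fun n => (√(n k : ℝ) : ℂ) • Finsupp.single (n - Pi.single k 1) 1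

/-- The creation operator `a_k†` of mode `k`: `a_k† |n⟩ = √(n_k + 1) |n + e_k⟩`. -/
noncomputable def creation {m : ℕ} (k : Fin m) : FiniteFock m →ₗ[ℂ] FiniteFock m :=
  Finsupp.linearCombination ℂ fun n => (√(n k + 1 : ℝ) : ℂ) • Finsupp.single (n + Pi.single k 1) 1

/-- The number operator `N = ∑ₖ a_k† a_k`. -/
noncomputable def numberOperator (m : ℕ) : FiniteFock m →ₗ[ℂ] FiniteFock m :=
  ∑ k, creation k ∘ₗ annihilation k

/-- The total boson number `|n| = ∑ₖ n_k`. -/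
def totalNumber {m : ℕ} (n : Fin m → ℕ) : ℕ := ∑ k, n k

/-- The generator `½ ∑ₖ r_k (a_k² - (a_k†)²)` of multimode squeezing. -/
noncomputable def squeezingGenerator {m : ℕ} (r : Fin m → ℝ) : FiniteFock m →ₗ[ℂ] FiniteFock m :=
  ∑ k, ((r k / 2 : ℝ) : ℂ) •
    (annihilation k ∘ₗ annihilation k - creation k ∘ₗ creation k)

/-- `U` is the strongly continuous one-parameter unitary group `τ ↦ exp (τ G)` generated by
`G = ½ ∑ₖ r_k (a_k² - (a_k†)²)`. As `G` is essentially skew-adjoint on the span of the Fock states,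
this determines `U`. -/
structure IsSqueezingGroup {m : ℕ} (r : Fin m → ℝ) (U : ℝ → (FockSpace m ≃ₗᵢ[ℂ] FockSpace m)) :
    Prop where
  map_add : ∀ σ τ, U (σ + τ) = (U τ).trans (U σ)
  continuous : ∀ ψ, Continuous fun τ => U τ ψ
  hasDerivAt : ∀ φ : FiniteFock m, HasDerivAt (fun τ : ℝ => U τ (toFockSpace φ))
    (toFockSpace (squeezingGenerator r φ)) 0

theorem annihilation_single {m : ℕ} (k : Fin m) (n : Fin m → ℕ) :
    annihilation k (Finsupp.single n 1)
      = (√(n k : ℝ) : ℂ) • Finsupp.single (n - Pi.single k 1) 1 := by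
  simp [annihilation]

theorem creation_single {m : ℕ} (k : Fin m) (n : Fin m → ℕ) :
    creation k (Finsupp.single n 1)
      = (√(n k + 1 : ℝ) : ℂ) • Finsupp.single (n + Pi.single k 1) 1 := by
  simp [creation]

/-- The Fock states are eigenvectors of the number operator: `N |n⟩ = |n| |n⟩`. -/
theorem numberOperator_single {m : ℕ} (n : Fin m → ℕ) :
    numberOperator m (Finsupp.single n 1) = (totalNumber n : ℂ) • Finsupp.single n 1 := by
  have h : ∀ k, creation k (annihilation k (Finsupp.single n 1))
      = (n k : ℂ) • (Finsupp.single n 1 : FiniteFock m) := by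
    intro k
    rw [annihilation_single, map_smul, creation_single, smul_smul]
    rcases Nat.eq_zero_or_pos (n k) with h0 | h0
    · simp [h0]
    · have e : n - Pi.single k 1 + Pi.single k 1 = n := by
        funext i
        by_cases hi : i = k
        · subst hi; simp; omega
        · simp [hi]
      have e2 : (((n - Pi.single k 1 : Fin m → ℕ) k : ℕ) : ℝ) + 1 = n k := by
        simp only [Pi.sub_apply, Pi.single_eq_same]
        rw [Nat.cast_sub h0]; simp
      rw [e, e2, ← Complex.ofReal_mul, Real.mul_self_sqrt (Nat.cast_nonneg _)]
      simp
  simp [numberOperator, h, totalNumber, Finset.sum_smul]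

theorem toFockSpace_apply {m : ℕ} (φ : FiniteFock m) (p : Fin m → ℕ) : toFockSpace φ p = φ p := by
  induction φ using Finsupp.induction_linear with
  | zero => simp
  | add x y hx hy => simp [hx, hy]
  | single n c => simp [toFockSpace, fockState, lp.single_apply, Finsupp.single_apply,
      Pi.single_apply, eq_comm]

/-- The real number `⟨p|a_k²|n⟩ = √(p_k + 1) √(p_k + 2)` if `n = p + 2 e_k`, and `0` otherwise. -/
noncomputable def lowerTwo {m : ℕ} (k : Fin m) (p n : Fin m → ℕ) : ℝ :=
  if n = p + Pi.single k 1 + Pi.single k 1 then √(p k + 1) * √(p k + 2) else 0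

/-- The matrix of the squeezing generator. -/
noncomputable def squeezingMatrix {m : ℕ} (r : Fin m → ℝ) (p n : Fin m → ℕ) : ℝ :=
  ∑ k, r k / 2 * (lowerTwo k p n - lowerTwo k n p)

theorem annihilation_annihilation_single_apply {m : ℕ} (k : Fin m) (p n : Fin m → ℕ) :
    annihilation k (annihilation k (Finsupp.single n 1)) p = (lowerTwo k p n : ℂ) := by
  rw [annihilation_single, map_smul, annihilation_single, smul_smul, lowerTwo]
  by_cases h : n = p + Pi.single k 1 + Pi.single k 1
  · subst h
    have e : ((p k : ℝ) + 1 + 1) = p k + 2 := by ring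
    simp [e, mul_comm]
  · rw [if_neg h]
    by_cases h2 : n - Pi.single k 1 - Pi.single k 1 = p
    · have h3 : n k < 2 := by
        by_contra h3
        apply h
        rw [← h2]
        funext i
        by_cases hi : i = k
        · subst hi; simp; omega
        · simp [hi]
      have : n k = 0 ∨ n k = 1 := by omega
      rcases this with h4 | h4 <;> simp [h4]
    · simp [h2]

theorem creation_creation_single_apply {m : ℕ} (k : Fin m) (p n : Fin m → ℕ) :
    creation k (creation k (Finsupp.single n 1)) p = (lowerTwo k n p : ℂ) := by
  rw [creation_single, map_smul, creation_single, smul_smul, lowerTwo]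
  have e : ((n k : ℝ) + 1 + 1) = n k + 2 := by ring
  by_cases h : p = n + Pi.single k 1 + Pi.single k 1
  · subst h
    simp [e]
  · simp [h]

theorem squeezingGenerator_single_apply {m : ℕ} (r : Fin m → ℝ) (p n : Fin m → ℕ) :
    squeezingGenerator r (Finsupp.single n 1) p = (squeezingMatrix r p n : ℂ) := by
  simp [squeezingGenerator, squeezingMatrix, annihilation_annihilation_single_apply,
    creation_creation_single_apply, Finsupp.finsetSum_apply]

theorem squeezingMatrix_antisymm {m : ℕ} (r : Fin m → ℝ) (p n : Fin m → ℕ) :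
    squeezingMatrix r p n = -squeezingMatrix r n p := by
  rw [squeezingMatrix, squeezingMatrix, ← Finset.sum_neg_distrib]
  exact Finset.sum_congr rfl fun k _ => by ring

theorem totalNumber_add_two {m : ℕ} (k : Fin m) (n : Fin m → ℕ) :
    totalNumber (n + Pi.single k 1 + Pi.single k 1) = totalNumber n + 2 := by
  simp [totalNumber, Finset.sum_add_distrib]

theorem squeezingMatrix_band {m : ℕ} (r : Fin m → ℝ) (p n : Fin m → ℕ)
    (h : squeezingMatrix r p n ≠ 0) : totalNumber p ≤ totalNumber n + 2 := by
  obtain ⟨k, -, hk⟩ := Finset.exists_ne_zero_of_sum_ne_zero h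
  by_cases h1 : n = p + Pi.single k 1 + Pi.single k 1
  · rw [h1, totalNumber_add_two]; omega
  by_cases h2 : p = n + Pi.single k 1 + Pi.single k 1
  · rw [h2, totalNumber_add_two]
  · simp [lowerTwo, h1, h2] at hk

theorem lowerTwo_nonneg {m : ℕ} (k : Fin m) (p n : Fin m → ℕ) : 0 ≤ lowerTwo k p n := by
  rw [lowerTwo]; split_ifs <;> positivity

theorem sqrt_mul_sqrt_le {m : ℕ} (k : Fin m) (p : Fin m → ℕ) :
    √(p k + 1 : ℝ) * √(p k + 2 : ℝ) ≤ totalNumber p + 2 := by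
  have h : (p k : ℝ) ≤ totalNumber p := by
    exact_mod_cast Finset.single_le_sum (f := p) (fun _ _ => Nat.zero_le _) (Finset.mem_univ k)
  have h0 : (0 : ℝ) ≤ p k := Nat.cast_nonneg _
  rw [← Real.sqrt_mul (by positivity)]
  refine Real.sqrt_le_iff.2 ⟨by linarith, by nlinarith⟩

theorem sum_lowerTwo_left {m : ℕ} (k : Fin m) (S : Finset (Fin m → ℕ)) (p : Fin m → ℕ) :
    ∑ n ∈ S, lowerTwo k p n ≤ totalNumber p + 2 := by
  simp only [lowerTwo, Finset.sum_ite_eq']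
  split_ifs
  · exact sqrt_mul_sqrt_le k p
  · positivity

theorem sum_lowerTwo_right {m : ℕ} (k : Fin m) (S : Finset (Fin m → ℕ)) (p : Fin m → ℕ) :
    ∑ n ∈ S, lowerTwo k n p ≤ totalNumber p + 2 := by
  have h : ∀ n ∈ S, lowerTwo k n p
      ≤ if n = p - Pi.single k 1 - Pi.single k 1 then (totalNumber p + 2 : ℝ) else 0 := by
    intro n _
    rw [lowerTwo]
    by_cases h1 : p = n + Pi.single k 1 + Pi.single k 1
    · have h2 : n = p - Pi.single k 1 - Pi.single k 1 := by rw [h1]; simp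
      rw [if_pos h1, if_pos h2, h1, totalNumber_add_two]
      have := sqrt_mul_sqrt_le k n
      push_cast; linarith
    · rw [if_neg h1]; split_ifs <;> positivity
  refine (Finset.sum_le_sum h).trans ?_
  rw [Finset.sum_ite_eq']
  split_ifs
  · exact le_rfl
  · positivity

theorem squeezingMatrix_row {m : ℕ} (r : Fin m → ℝ) (S : Finset (Fin m → ℕ)) (p : Fin m → ℕ) :
    ∑ n ∈ S, |squeezingMatrix r p n| ≤ (2 * ∑ k, |r k|) * (totalNumber p + 1) := by
  have h : ∀ n ∈ S, |squeezingMatrix r p n|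
      ≤ ∑ k, |r k| / 2 * (lowerTwo k p n + lowerTwo k n p) := by
    intro n _
    refine (Finset.abs_sum_le_sum_abs _ _).trans (Finset.sum_le_sum fun k _ => ?_)
    rw [abs_mul, abs_div, abs_two]
    refine mul_le_mul_of_nonneg_left ?_ (by positivity)
    have := lowerTwo_nonneg k p n
    have := lowerTwo_nonneg k n p
    rw [abs_le]; constructor <;> linarith
  refine (Finset.sum_le_sum h).trans ?_
  rw [Finset.sum_comm, Finset.mul_sum, Finset.sum_mul]
  refine Finset.sum_le_sum fun k _ => ?_
  rw [← Finset.mul_sum, Finset.sum_add_distrib]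
  have h1 := sum_lowerTwo_left k S p
  have h2 := sum_lowerTwo_right k S p
  have h3 : (0 : ℝ) ≤ totalNumber p := Nat.cast_nonneg _
  have h4 := abs_nonneg (r k)
  have h5 : ∑ n ∈ S, lowerTwo k p n + ∑ n ∈ S, lowerTwo k n p ≤ 4 * (totalNumber p + 1) := by
    linarith
  have := mul_le_mul_of_nonneg_left h5 (by positivity : 0 ≤ |r k| / 2)
  linarith

theorem finite_totalNumber_le (m K : ℕ) : {n : Fin m → ℕ | totalNumber n ≤ K}.Finite :=
  (Set.finite_Iic (fun _ : Fin m => K)).subset fun n hn k =>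
    (Finset.single_le_sum (f := n) (fun _ _ => Nat.zero_le _) (Finset.mem_univ k)).trans hn

theorem squeezingGenerator_apply {m : ℕ} (r : Fin m → ℝ) (φ : FiniteFock m) (p : Fin m → ℕ) :
    squeezingGenerator r φ p = φ.sum fun n c => c * (squeezingMatrix r p n : ℂ) := by
  conv_lhs => rw [← Finsupp.sum_single φ]
  rw [map_finsuppSum, Finsupp.sum, Finsupp.finsetSum_apply, Finsupp.sum]
  refine Finset.sum_congr rfl fun n _ => ?_
  have : Finsupp.single n (φ n) = φ n • (Finsupp.single n 1 : FiniteFock m) := by simp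
  rw [this, map_smul, Finsupp.smul_apply, squeezingGenerator_single_apply, smul_eq_mul]

theorem eventually_compressedMatrixOp {m : ℕ} (r : Fin m → ℝ) (φ : FiniteFock m) :
    ∀ᶠ K in atTop, compressedMatrixOp (squeezingMatrix r) (finite_totalNumber_le m K).toFinset
      (toFockSpace φ) = toFockSpace (squeezingGenerator r φ) := by
  have key : ∀ S : Finset (Fin m → ℕ), ∀ᶠ K in atTop, S ⊆ (finite_totalNumber_le m K).toFinset := by
    intro S
    filter_upwards [eventually_ge_atTop (S.sup totalNumber)] with K hK n hn
    simpa using (Finset.le_sup (f := totalNumber) hn).trans hK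
  filter_upwards [key φ.support, key (squeezingGenerator r φ).support] with K h1 h2
  ext p
  rw [compressedMatrixOp_apply, toFockSpace_apply]
  split_ifs with hp
  · rw [squeezingGenerator_apply, Finsupp.sum]
    simp_rw [toFockSpace_apply]
    symm
    refine (Finset.sum_subset h1 fun n _ hn => ?_).trans
      (Finset.sum_congr rfl fun n _ => mul_comm _ _)
    rw [Finsupp.notMem_support_iff.1 hn, zero_mul]
  · exact (Finsupp.notMem_support_iff.1 fun h => hp (h2 h)).symm

theorem dense_span_fockState (m : ℕ) :
    Dense (Submodule.span ℂ (Set.range (fockState (m := m))) : Set (FockSpace m)) := by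
  intro x
  refine mem_closure_of_tendsto (lp.hasSum_single ENNReal.ofNat_ne_top x)
    (Eventually.of_forall fun S => Submodule.sum_mem _ fun n _ => ?_)
  have : lp.single (E := fun _ : Fin m → ℕ => ℂ) 2 n (x n) = x n • fockState n := by
    rw [fockState, ← lp.single_smul, smul_eq_mul, mul_one]
  rw [this]
  exact Submodule.smul_mem _ _ (Submodule.subset_span ⟨n, rfl⟩)

theorem exists_isSqueezingGroup {m : ℕ} (r : Fin m → ℝ) : ∃ U, IsSqueezingGroup r U := by
  have hs : ∀ n : Fin m → ℕ, toFockSpace (Finsupp.single n 1) = fockState n := by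
    intro n; simp [toFockSpace]
  obtain ⟨U, h1, h2, h3⟩ := exists_unitaryGroup_of_cauchySeq
    (fun K => compressedMatrixOp (squeezingMatrix r) (finite_totalNumber_le m K).toFinset)
    (fun K => compressedMatrixOp_mem_skewAdjoint _ (squeezingMatrix_antisymm r) _)
    (Set.range fockState) (dense_span_fockState m)
    (by
      rintro _ ⟨n, rfl⟩ τ
      exact cauchySeq_exp_compressedMatrixOp (squeezingMatrix r) (squeezingMatrix_antisymm r)
        totalNumber _ (by simp) (squeezingMatrix_band r) (2 * ∑ k, |r k|) (by positivity)
        (squeezingMatrix_row r) n τ)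
    (by
      rintro _ ⟨n, rfl⟩
      exact ⟨_, by simpa only [hs] using eventually_compressedMatrixOp r (Finsupp.single n 1)⟩)
  exact ⟨U, h1, h2, fun φ => h3 _ _ _ (eventually_compressedMatrixOp r φ)
    (eventually_compressedMatrixOp r _)⟩

/-- The multimode squeezing operator `S(r) = exp (½ ∑ₖ r_k (a_k² - (a_k†)²))`. -/
noncomputable def squeezing {m : ℕ} (r : Fin m → ℝ) : FockSpace m ≃ₗᵢ[ℂ] FockSpace m :=
  (exists_isSqueezingGroup r).choose 1

/-- The expectation value `⟨ψ|t^N|ψ⟩ = ∑ₙ t^|n| |ψₙ|² ∈ [0, ∞]` of the exponential-energy operator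
`t^N` for `t ≥ 0`; here `t^N` is the function `x ↦ t^x` of the number operator, that is
`t^N |n⟩ = t^|n| |n⟩`. It is finite exactly if `ψ` is in the form domain of `t^N`. -/
noncomputable def expEnergy {m : ℕ} (t : ℝ) (ψ : FockSpace m) : ENNReal :=
  ∑' n : Fin m → ℕ, ENNReal.ofReal (t ^ totalNumber n * ‖ψ n‖ ^ 2)

/-- The threshold `f(r, s) = 1 + (s - 1) / (e^{2r} + sinh r e^r (s - 1))`. -/
noncomputable def squeezeThreshold (r s : ℝ) : ℝ :=
  1 + (s - 1) / (Real.exp (2 * r) + Real.sinh r * Real.exp r * (s - 1))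

/-- The function `g(r, s, t)`. -/
noncomputable def squeezeFactor (r s t : ℝ) : ℝ :=
  s * √((Real.exp (2 * r) + Real.sinh r * Real.exp r * (s - 1)) /
      (Real.exp (-2 * r) - Real.sinh r * Real.exp (-r) * (s - 1))) *
    (1 / ((s - 1) - (t - 1) * (Real.exp (2 * r) + Real.sinh r * Real.exp r * (s - 1))))

end Bosonic

namespace Bosonic

open Filter Topology

/-! The argument is a monotonicity formula along the squeezing group `U τ`. Write E(σ, φ) = Σ σ^|n|
|φ_n|². The generator couples only n and n + 2e_k, with matrix element of size r_k
√((n_k+1)(n_k+2))/2. By Cauchy–Schwarz and AM-GM, for fixed σ > 1, the rate of growth of E(σ, U τ ψ)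
is at most R(σ - σ⁻¹) Σ (|n| + m/2) σ^|n| |φ_n|², where φ = U τ ψ. Now let σ vary with σ' = -R(σ² -
1). The change of weight contributes -R(σ - σ⁻¹) Σ |n| σ^|n| |φ_n|², which cancels the |n| term. The
m/2 term is cancelled by a prefactor σ^{m/2}. Hence σ^{m/2} E(σ, U τ ψ) does not increase.

This Riccati equation started at s reaches f(R, s) at time 1, so E(f, Sψ) ≤ (s/f)^{m/2} E(s, ψ)
(`expEnergy_squeezing_threshold_le`). For t < f the energy is smaller still, and both claims reduce
to the scalar inequalities that √(s/f) is below the stated constants.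

Since ψ need not lie in the domain of the generator and E may be infinite, the weight is replaced by
the bounded σ^min(|n|, K). `IsSqueezingGroup.exists_hasDerivAt_cutoffEnergy` shows that the
cancellation survives the truncation, and `IsSqueezingGroup.rpow_mul_cutoffEnergy_le` integrates it.
Letting K grow gives the bound for E. -/

/-! ### Differential equations for the Fock amplitudes of an orbit. -/

theorem mem_finite_totalNumber_le {m K : ℕ} (p : Fin m → ℕ) :
    p ∈ (finite_totalNumber_le m K).toFinset ↔ totalNumber p ≤ K := by simp

theorem IsSqueezingGroup.zero_apply {m : ℕ} {r : Fin m → ℝ}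
    {U : ℝ → (FockSpace m ≃ₗᵢ[ℂ] FockSpace m)} (hU : IsSqueezingGroup r U) (ψ : FockSpace m) :
    U 0 ψ = ψ := by
  have h := congrArg (fun V : FockSpace m ≃ₗᵢ[ℂ] FockSpace m => V ψ) (hU.map_add 0 0)
  simp only [add_zero, LinearIsometryEquiv.trans_apply] at h
  exact ((U 0).injective h).symm

theorem IsSqueezingGroup.inner_apply {m : ℕ} {r : Fin m → ℝ}
    {U : ℝ → (FockSpace m ≃ₗᵢ[ℂ] FockSpace m)} (hU : IsSqueezingGroup r U) (τ : ℝ)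
    (χ ψ : FockSpace m) : inner ℂ χ (U τ ψ) = inner ℂ (U (-τ) χ) ψ := by
  rw [← (U (-τ)).inner_map_map χ (U τ ψ)]
  have h := congrArg (fun V : FockSpace m ≃ₗᵢ[ℂ] FockSpace m => V ψ) (hU.map_add (-τ) τ)
  simp only [neg_add_cancel, LinearIsometryEquiv.trans_apply, hU.zero_apply] at h
  rw [← h]

/-- The group law carries the derivative at 0 to any time, since `U τ` is linear and bounded. -/
theorem IsSqueezingGroup.hasDerivAt_toFockSpace {m : ℕ} {r : Fin m → ℝ}
    {U : ℝ → (FockSpace m ≃ₗᵢ[ℂ] FockSpace m)} (hU : IsSqueezingGroup r U) (φ : FiniteFock m)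
    (τ : ℝ) : HasDerivAt (fun u : ℝ => U u (toFockSpace φ))
      (U τ (toFockSpace (squeezingGenerator r φ))) τ := by
  have h0 : HasDerivAt (fun u : ℝ => U u (toFockSpace φ))
      (toFockSpace (squeezingGenerator r φ)) (τ + -τ) := by
    rw [add_neg_cancel]; exact hU.hasDerivAt φ
  have h1 := h0.comp_add_const τ (-τ)
  have h2 := (((U τ).toContinuousLinearEquiv : FockSpace m →L[ℂ] FockSpace m).restrictScalars
    ℝ).hasFDerivAt.comp_hasDerivAt τ h1
  refine h2.congr_of_eventuallyEq (Eventually.of_forall fun u => ?_)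
  have h := congrArg (fun V : FockSpace m ≃ₗᵢ[ℂ] FockSpace m => V (toFockSpace φ))
    (hU.map_add τ (u + -τ))
  simp only [LinearIsometryEquiv.trans_apply] at h
  rw [show τ + (u + -τ) = u by ring] at h
  exact h

theorem inner_fockState {m : ℕ} (p : Fin m → ℕ) (ψ : FockSpace m) :
    inner ℂ (fockState p) ψ = ψ p := by
  simp [fockState, lp.inner_single_left]

/-- The Fock amplitudes of an orbit of the squeezing group solve the ODE with the matrix of the
generator. -/
theorem IsSqueezingGroup.hasDerivAt_apply {m : ℕ} {r : Fin m → ℝ}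
    {U : ℝ → (FockSpace m ≃ₗᵢ[ℂ] FockSpace m)} (hU : IsSqueezingGroup r U) (ψ : FockSpace m)
    (p : Fin m → ℕ) {L : ℕ} (hL : totalNumber p + 2 ≤ L) (τ : ℝ) :
    HasDerivAt (fun u : ℝ => U u ψ p)
      (∑ n ∈ (finite_totalNumber_le m L).toFinset, (squeezingMatrix r p n : ℂ) * U τ ψ n) τ := by
  set e : FiniteFock m := Finsupp.single p 1
  have he : toFockSpace e = fockState p := by simp [e, toFockSpace]
  -- The vector ψ is arbitrary, so its orbit need not be differentiable. By unitarity the evolution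
  -- is moved to the Fock state, ⟨p|U τ ψ⟩ = ⟨U (-τ) p|ψ⟩, which is differentiable.
  have h1 := (hU.hasDerivAt_toFockSpace e (-τ)).scomp τ (hasDerivAt_neg τ)
  have h2 : HasDerivAt (fun u : ℝ => inner ℂ (U (-u) (toFockSpace e)) ψ)
      (inner ℂ ((-1 : ℝ) • U (-τ) (toFockSpace (squeezingGenerator r e))) ψ) τ := by
    simpa using h1.inner ℂ (hasDerivAt_const τ ψ)
  have h3 : (fun u : ℝ => inner ℂ (U (-u) (toFockSpace e)) ψ) = fun u => U u ψ p := by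
    funext u
    rw [← hU.inner_apply, he, inner_fockState]
  rw [h3] at h2
  refine h2.congr_deriv ?_
  have h4 : (-1 : ℝ) • U (-τ) (toFockSpace (squeezingGenerator r e))
      = U (-τ) (-toFockSpace (squeezingGenerator r e)) := by simp
  have h5 : toFockSpace (squeezingGenerator r e)
      = ∑ n ∈ (finite_totalNumber_le m L).toFinset, (squeezingMatrix r n p : ℂ) • fockState n := by
    rw [toFockSpace, Finsupp.linearCombination_apply, Finsupp.sum]
    simp_rw [e, squeezingGenerator_single_apply]
    refine Finset.sum_subset (fun n hn => ?_) (fun n _ hn => ?_)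
    · rw [mem_finite_totalNumber_le]
      rw [Finsupp.mem_support_iff, squeezingGenerator_single_apply] at hn
      exact (squeezingMatrix_band r n p (by exact_mod_cast hn)).trans hL
    · rw [Finsupp.notMem_support_iff, squeezingGenerator_single_apply] at hn
      rw [hn, zero_smul]
  rw [h4, ← hU.inner_apply, inner_neg_left, h5, sum_inner, ← Finset.sum_neg_distrib]
  refine Finset.sum_congr rfl fun n _ => ?_
  rw [inner_smul_left, inner_fockState, squeezingMatrix_antisymm r p n]
  simp

/-! ### The flux of a weight along the squeezing flow. -/

/-- Swapping p and n in one of the two copies of the sum leaves only differences of weights, so a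
constant weight has no flux and the flux of a slowly varying one is small. -/
theorem sum_mul_inner_antisymm {ι : Type*} (g : ι → ι → ℝ) (hg : ∀ p n, g p n = -g n p)
    (F : Finset ι) (c : ι → ℝ) (x : ι → ℂ) :
    ∑ p ∈ F, c p * (2 * inner ℝ (x p) (∑ n ∈ F, (g p n : ℂ) * x n))
      = ∑ p ∈ F, ∑ n ∈ F, g p n * (c p - c n) * inner ℝ (x p) (x n) := by
  have e1 : ∑ p ∈ F, c p * (2 * inner ℝ (x p) (∑ n ∈ F, (g p n : ℂ) * x n))
      = 2 * ∑ p ∈ F, ∑ n ∈ F, c p * g p n * inner ℝ (x p) (x n) := by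
    rw [Finset.mul_sum]
    refine Finset.sum_congr rfl fun p _ => ?_
    rw [inner_sum, Finset.mul_sum, Finset.mul_sum, Finset.mul_sum]
    refine Finset.sum_congr rfl fun n _ => ?_
    rw [← Complex.real_smul, inner_smul_right]; ring
  have e2 : ∑ p ∈ F, ∑ n ∈ F, c p * g p n * inner ℝ (x p) (x n)
      = ∑ p ∈ F, ∑ n ∈ F, - (c n * g p n * inner ℝ (x p) (x n)) := by
    rw [Finset.sum_comm]
    refine Finset.sum_congr rfl fun p _ => Finset.sum_congr rfl fun n _ => ?_
    rw [hg n p, real_inner_comm]; ring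
  rw [e1, two_mul]; nth_rewrite 2 [e2]
  rw [← Finset.sum_add_distrib]
  refine Finset.sum_congr rfl fun p _ => ?_
  rw [← Finset.sum_add_distrib]
  exact Finset.sum_congr rfl fun n _ => by ring

/-- The weight difference is antisymmetric and the inner product symmetric, so the lowering and
raising halves of the matrix contribute equally and the factor 1/2 disappears. -/
theorem sum_squeezingMatrix_mul {m : ℕ} (r : Fin m → ℝ) (F : Finset (Fin m → ℕ))
    (w : (Fin m → ℕ) → ℝ) (x : (Fin m → ℕ) → ℂ) :
    ∑ p ∈ F, ∑ n ∈ F, squeezingMatrix r p n * (w p - w n) * inner ℝ (x p) (x n)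
      = ∑ k, r k * ∑ p ∈ F, ∑ n ∈ F, lowerTwo k p n * (w p - w n) * inner ℝ (x p) (x n) := by
  have h : ∀ k, ∑ p ∈ F, ∑ n ∈ F, lowerTwo k n p * (w p - w n) * inner ℝ (x p) (x n)
      = - ∑ p ∈ F, ∑ n ∈ F, lowerTwo k p n * (w p - w n) * inner ℝ (x p) (x n) := by
    intro k
    rw [Finset.sum_comm, ← Finset.sum_neg_distrib]
    refine Finset.sum_congr rfl fun p _ => ?_
    rw [← Finset.sum_neg_distrib]
    refine Finset.sum_congr rfl fun n _ => ?_
    rw [real_inner_comm]; ring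
  have h2 : ∀ k, r k * ∑ p ∈ F, ∑ n ∈ F, lowerTwo k p n * (w p - w n) * inner ℝ (x p) (x n)
      = ∑ p ∈ F, ∑ n ∈ F, r k / 2 * (lowerTwo k p n - lowerTwo k n p) * (w p - w n)
        * inner ℝ (x p) (x n) := by
    intro k
    have : ∑ p ∈ F, ∑ n ∈ F, r k / 2 * (lowerTwo k p n - lowerTwo k n p) * (w p - w n)
        * inner ℝ (x p) (x n)
        = r k / 2 * (∑ p ∈ F, ∑ n ∈ F, lowerTwo k p n * (w p - w n) * inner ℝ (x p) (x n)
          - ∑ p ∈ F, ∑ n ∈ F, lowerTwo k n p * (w p - w n) * inner ℝ (x p) (x n)) := by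
      rw [← Finset.sum_sub_distrib, Finset.mul_sum]
      refine Finset.sum_congr rfl fun p _ => ?_
      rw [← Finset.sum_sub_distrib, Finset.mul_sum]
      exact Finset.sum_congr rfl fun n _ => by ring
    rw [this, h k]; ring
  simp_rw [h2]
  symm
  rw [Finset.sum_comm]
  refine Finset.sum_congr rfl fun p _ => ?_
  rw [Finset.sum_comm]
  refine Finset.sum_congr rfl fun n _ => ?_
  rw [squeezingMatrix, Finset.sum_mul, Finset.sum_mul]

/-- Without truncation this is an equality. If both exponents are cut off the left side vanishes. If
only j + 2 is cut off, to j + 1, the right side exceeds the left by the factor (σ + 1)²/σ ≥ 1. -/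
theorem sq_pow_min_sub_le {σ : ℝ} (hσ : 1 < σ) (j K : ℕ) :
    (σ ^ min j K - σ ^ min (j + 2) K) ^ 2
      ≤ (σ - σ⁻¹) ^ 2 * (σ ^ min j K * σ ^ min (j + 2) K) := by
  have h0 : 0 < σ := by linarith
  rcases le_or_gt K j with h | h
  · rw [min_eq_right h, min_eq_right (by omega : K ≤ j + 2), sub_self, zero_pow two_ne_zero]
    have := pow_pos h0 K
    positivity
  · rw [min_eq_left h.le]
    rcases Nat.lt_or_ge (j + 1) K with h1 | h1
    · rw [min_eq_left (by omega : j + 2 ≤ K), pow_add]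
      refine le_of_eq ?_
      field_simp
      ring
    · rw [min_eq_right (by omega : K ≤ j + 2), show K = j + 1 by omega, pow_succ σ j]
      have e1 : (σ ^ j - σ ^ j * σ) ^ 2 = (σ ^ j) ^ 2 * (σ - 1) ^ 2 := by ring
      have e2 : (σ - σ⁻¹) ^ 2 * (σ ^ j * (σ ^ j * σ))
          = (σ ^ j) ^ 2 * ((σ - 1) ^ 2 * ((σ + 1) ^ 2 / σ)) := by field_simp; ring
      rw [e1, e2]
      have : 1 ≤ (σ + 1) ^ 2 / σ := by rw [le_div_iff₀ h0]; nlinarith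
      refine mul_le_mul_of_nonneg_left ?_ (sq_nonneg _)
      exact le_mul_of_one_le_right (sq_nonneg _) this

/-- For fixed k, each index is the lower end of at most one pair (p, p + 2e_k) and the upper end of
at most one. -/
theorem sum_sum_add_two_le {m : ℕ} (k : Fin m) (F : Finset (Fin m → ℕ)) (α β : (Fin m → ℕ) → ℝ)
    (hα : ∀ n, 0 ≤ α n) (hβ : ∀ n, 0 ≤ β n) :
    ∑ p ∈ F, ∑ n ∈ F, (if n = p + Pi.single k 1 + Pi.single k 1 then α p + β n else 0)
      ≤ ∑ n ∈ F, (α n + β n) := by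
  have h : ∀ p n, (if n = p + Pi.single k 1 + Pi.single k 1 then α p + β n else 0)
      = (if n = p + Pi.single k 1 + Pi.single k 1 then α p else 0)
        + (if n = p + Pi.single k 1 + Pi.single k 1 then β n else 0) := by
    intro p n; split_ifs <;> simp
  simp_rw [h, Finset.sum_add_distrib]
  refine add_le_add (Finset.sum_le_sum fun p _ => ?_) ?_
  · rw [Finset.sum_ite_eq']
    split_ifs
    · exact le_rfl
    · exact hα p
  · rw [Finset.sum_comm]
    refine Finset.sum_le_sum fun n _ => ?_
    rw [← Finset.sum_filter]
    -- The lower end is recovered from n by subtracting e_k twice, so the filtered set has at most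
    -- one element.
    refine (Finset.sum_le_sum_of_subset_of_nonneg
      (t := {n - Pi.single k 1 - Pi.single k 1}) (fun p hp => ?_) fun _ _ _ => hβ n).trans (by simp)
    rw [Finset.mem_singleton, (Finset.mem_filter.1 hp).2]
    simp

/-- The truncated weight `σ^min(|n|, K)`. -/
noncomputable def cutoffWeight {m : ℕ} (σ : ℝ) (K : ℕ) (n : Fin m → ℕ) : ℝ :=
  σ ^ min (totalNumber n) K

/-- AM-GM assigns the factor p_k + 1 to the lower end and p_k + 2 = n_k to the upper end. When |p| ≥
K both weights are σ^K and the left side vanishes; dropping the lower term there is what keeps the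
flux at the cutoff under control. -/
theorem lowerTwo_mul_cutoffWeight_le {m : ℕ} {σ : ℝ} (hσ : 1 < σ) (K : ℕ) (k : Fin m)
    (x : (Fin m → ℕ) → ℂ) (p n : Fin m → ℕ) :
    lowerTwo k p n * (cutoffWeight σ K p - cutoffWeight σ K n) * inner ℝ (x p) (x n)
      ≤ (σ - σ⁻¹) / 2 * (if n = p + Pi.single k 1 + Pi.single k 1 then
        (if totalNumber p < K then (p k + 1) * (cutoffWeight σ K p * ‖x p‖ ^ 2) else 0)
          + n k * (cutoffWeight σ K n * ‖x n‖ ^ 2) else 0) := by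
  have h0 : 0 < σ := by linarith
  have hd : 0 ≤ σ - σ⁻¹ := by
    have := inv_lt_one_of_one_lt₀ hσ
    linarith
  have hw : ∀ q : Fin m → ℕ, 0 < cutoffWeight σ K q := fun q => pow_pos h0 _
  rw [lowerTwo]
  split_ifs with h h1
  · have hn : totalNumber n = totalNumber p + 2 := by rw [h, totalNumber_add_two]
    have hnk : (n k : ℝ) = p k + 2 := by rw [h]; simp; ring
    rw [hnk]
    set A := ((p k : ℝ) + 1) * (cutoffWeight σ K p * ‖x p‖ ^ 2) with hA
    set B := ((p k : ℝ) + 2) * (cutoffWeight σ K n * ‖x n‖ ^ 2) with hB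
    have hA0 : 0 ≤ A := by have := hw p; positivity
    have hB0 : 0 ≤ B := by have := hw n; positivity
    -- Comparing squares removes the square roots of the matrix element and brings in
    -- `sq_pow_min_sub_le`.
    refine le_of_abs_le (abs_le_of_sq_le_sq ?_ (by positivity))
    have hi : (inner ℝ (x p) (x n)) ^ 2 ≤ (‖x p‖ * ‖x n‖) ^ 2 := by
      rw [← sq_abs (inner ℝ (x p) (x n))]
      exact pow_le_pow_left₀ (abs_nonneg _) (abs_real_inner_le_norm _ _) 2
    have hq := sq_pow_min_sub_le hσ (totalNumber p) K
    rw [← hn] at hq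
    change (cutoffWeight σ K p - cutoffWeight σ K n) ^ 2
      ≤ (σ - σ⁻¹) ^ 2 * (cutoffWeight σ K p * cutoffWeight σ K n) at hq
    calc _ = ((p k : ℝ) + 1) * (p k + 2) * ((cutoffWeight σ K p - cutoffWeight σ K n) ^ 2
          * (inner ℝ (x p) (x n)) ^ 2) := by
          rw [mul_pow, mul_pow, mul_pow, Real.sq_sqrt (by positivity), Real.sq_sqrt (by positivity)]
          ring
      _ ≤ ((p k : ℝ) + 1) * (p k + 2) * (((σ - σ⁻¹) ^ 2 * (cutoffWeight σ K p *
          cutoffWeight σ K n)) * (‖x p‖ * ‖x n‖) ^ 2) := by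
          have := hw p
          have := hw n
          gcongr
      _ = (σ - σ⁻¹) ^ 2 * (A * B) := by rw [hA, hB]; ring
      _ ≤ (σ - σ⁻¹) ^ 2 * ((A + B) / 2) ^ 2 := by
          refine mul_le_mul_of_nonneg_left ?_ (sq_nonneg _)
          nlinarith [sq_nonneg (A - B)]
      _ = _ := by ring
  · have hn : totalNumber n = totalNumber p + 2 := by rw [h, totalNumber_add_two]
    have : cutoffWeight σ K p = cutoffWeight σ K n := by
      rw [cutoffWeight, cutoffWeight, min_eq_right (by omega), min_eq_right (by omega)]
    rw [this, sub_self, mul_zero, zero_mul]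
    have := hw n
    positivity
  · simp

/-- The flux of the truncated weight along the squeezing flow. -/
theorem sum_squeezingMatrix_mul_cutoffWeight_le {m : ℕ} {r : Fin m → ℝ} {R : ℝ}
    (hr : ∀ k, 0 ≤ r k) (hR0 : 0 ≤ R) (hR : ∀ k, r k ≤ R) {σ : ℝ} (hσ : 1 < σ) {K : ℕ} (hK : 1 ≤ K)
    (x : (Fin m → ℕ) → ℂ) :
    ∑ p ∈ (finite_totalNumber_le m (K + 1)).toFinset,
      ∑ n ∈ (finite_totalNumber_le m (K + 1)).toFinset,
        squeezingMatrix r p n * (cutoffWeight σ K p - cutoffWeight σ K n) * inner ℝ (x p) (x n)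
      ≤ R * (σ - σ⁻¹) * ∑ n ∈ (finite_totalNumber_le m (K + 1)).toFinset,
        (min (totalNumber n) K + (m : ℝ) / 2) * (cutoffWeight σ K n * ‖x n‖ ^ 2) := by
  set F := (finite_totalNumber_le m (K + 1)).toFinset with hF
  have h0 : 0 < σ := by linarith
  have hd : 0 ≤ σ - σ⁻¹ := by
    have := inv_lt_one_of_one_lt₀ hσ
    linarith
  have hw : ∀ q : Fin m → ℕ, 0 ≤ cutoffWeight σ K q * ‖x q‖ ^ 2 := fun q => by
    have := pow_pos h0 (min (totalNumber q) K)
    rw [cutoffWeight]; positivity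
  rw [sum_squeezingMatrix_mul]
  have key : ∀ k, r k * ∑ p ∈ F, ∑ n ∈ F, lowerTwo k p n *
      (cutoffWeight σ K p - cutoffWeight σ K n) * inner ℝ (x p) (x n)
      ≤ R * (σ - σ⁻¹) * ∑ n ∈ F, ((if totalNumber n < K then (n k + 1) *
        (cutoffWeight σ K n * ‖x n‖ ^ 2) else 0) + n k * (cutoffWeight σ K n * ‖x n‖ ^ 2)) / 2 := by
    intro k
    have hα : ∀ n : Fin m → ℕ, 0 ≤ if totalNumber n < K then ((n k : ℝ) + 1) *
        (cutoffWeight σ K n * ‖x n‖ ^ 2) else 0 := by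
      intro n
      have := hw n
      split_ifs <;> positivity
    have hβ : ∀ n : Fin m → ℕ, 0 ≤ (n k : ℝ) * (cutoffWeight σ K n * ‖x n‖ ^ 2) := by
      intro n
      have := hw n
      positivity
    have h1 := Finset.sum_le_sum fun p (_ : p ∈ F) => Finset.sum_le_sum fun n (_ : n ∈ F) =>
      lowerTwo_mul_cutoffWeight_le hσ K k x p n
    simp_rw [← Finset.mul_sum] at h1
    have h2 := h1.trans (mul_le_mul_of_nonneg_left (sum_sum_add_two_le k F _ _ hα hβ)
      (by positivity))
    refine (mul_le_mul_of_nonneg_left h2 (hr k)).trans ?_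
    rw [← Finset.sum_div]
    have h3 : 0 ≤ ∑ n ∈ F, ((if totalNumber n < K then (n k + 1) *
        (cutoffWeight σ K n * ‖x n‖ ^ 2) else 0) + n k * (cutoffWeight σ K n * ‖x n‖ ^ 2)) :=
      Finset.sum_nonneg fun n _ => add_nonneg (hα n) (hβ n)
    have h4 := mul_le_mul_of_nonneg_right (hR k)
      (mul_nonneg (by positivity : 0 ≤ (σ - σ⁻¹) / 2) h3)
    refine h4.trans (le_of_eq (by ring))
  refine (Finset.sum_le_sum fun k _ => key k).trans ?_
  rw [← Finset.mul_sum, Finset.sum_comm]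
  refine mul_le_mul_of_nonneg_left (Finset.sum_le_sum fun n hn => ?_) (by positivity)
  have hn' : totalNumber n ≤ K + 1 := (mem_finite_totalNumber_le n).1 hn
  have hs : ∑ k, (n k : ℝ) = totalNumber n := by simp [totalNumber]
  rw [← Finset.sum_div, Finset.sum_add_distrib, ← Finset.sum_mul, hs]
  -- Below the cutoff, (2n_k + 1)/2 sums over k to |n| + m/2. From the cutoff on only the upper ends
  -- remain and give |n|/2 ≤ (K + 1)/2 ≤ K, because the sum stops at |n| = K + 1 and K ≥ 1.
  split_ifs with h
  · rw [← Finset.sum_mul, Finset.sum_add_distrib, hs, min_eq_left (by exact_mod_cast h.le)]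
    simp only [Finset.sum_const, Finset.card_univ, Fintype.card_fin, nsmul_eq_mul, mul_one]
    exact le_of_eq (by ring)
  · rw [min_eq_right (by exact_mod_cast not_lt.1 h)]
    have h5 : (totalNumber n : ℝ) ≤ K + 1 := by exact_mod_cast hn'
    have h6 : (1 : ℝ) ≤ K := by exact_mod_cast hK
    have h7 : (0 : ℝ) ≤ m := Nat.cast_nonneg _
    have := hw n
    simp only [Finset.sum_const_zero, zero_add]
    rw [mul_div_right_comm]
    refine mul_le_mul_of_nonneg_right ?_ this
    linarith

/-! ### The truncated energy and its monotonicity. -/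

theorem sum_norm_sq_le {m : ℕ} (F : Finset (Fin m → ℕ)) (ψ : FockSpace m) :
    ∑ n ∈ F, ‖ψ n‖ ^ 2 ≤ ‖ψ‖ ^ 2 := by
  have := lp.sum_rpow_le_norm_rpow (p := 2) (by norm_num) ψ F
  simpa using this

/-- The expectation value of the truncated weight `σ^min(|n|, K)`. -/
noncomputable def cutoffEnergy {m : ℕ} (σ : ℝ) (K : ℕ) (ψ : FockSpace m) : ℝ :=
  σ ^ K * ‖ψ‖ ^ 2 + ∑ n ∈ (finite_totalNumber_le m (K + 1)).toFinset,
    (cutoffWeight σ K n - σ ^ K) * ‖ψ n‖ ^ 2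

/-- Displays the mass outside the finite set, carried with weight σ^K. The defining form suits
differentiation, since the norm is conserved and only finitely many amplitudes appear. -/
theorem cutoffEnergy_eq {m : ℕ} (σ : ℝ) (K : ℕ) (ψ : FockSpace m) :
    cutoffEnergy σ K ψ = (∑ n ∈ (finite_totalNumber_le m (K + 1)).toFinset,
      cutoffWeight σ K n * ‖ψ n‖ ^ 2) + σ ^ K *
        (‖ψ‖ ^ 2 - ∑ n ∈ (finite_totalNumber_le m (K + 1)).toFinset, ‖ψ n‖ ^ 2) := by
  simp only [cutoffEnergy, sub_mul, Finset.sum_sub_distrib, ← Finset.mul_sum]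
  ring

theorem hasDerivAt_cutoffWeight {m : ℕ} {σ : ℝ → ℝ} {σ' τ : ℝ} (hσ : HasDerivAt σ σ' τ)
    (h0 : σ τ ≠ 0) (K : ℕ) (n : Fin m → ℕ) :
    HasDerivAt (fun u => cutoffWeight (σ u) K n)
      (min (totalNumber n) K * (cutoffWeight (σ τ) K n * (σ' / σ τ))) τ := by
  refine (hσ.pow (min (totalNumber n) K)).congr_deriv ?_
  rw [cutoffWeight]
  -- The rewriting σ^(j-1) = σ^j/σ fails for j = 0 under truncated subtraction, but the factor j
  -- then makes both sides zero.
  rcases Nat.eq_zero_or_pos (min (totalNumber n) K) with h | h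
  · rw [h]; simp
  · obtain ⟨j, hj⟩ := Nat.exists_eq_add_of_lt h
    rw [hj]
    simp only [zero_add, Nat.add_sub_cancel, pow_succ]
    field_simp

/-- Because σ'/σ = -R(σ - σ⁻¹), the decrease of the weight absorbs the min(|n|, K) part of the flux,
and only the m/2 part is left. -/
theorem IsSqueezingGroup.exists_hasDerivAt_cutoffEnergy {m : ℕ} {r : Fin m → ℝ}
    {U : ℝ → (FockSpace m ≃ₗᵢ[ℂ] FockSpace m)} (hU : IsSqueezingGroup r U) {R : ℝ}
    (hr : ∀ k, 0 ≤ r k) (hR0 : 0 ≤ R) (hR : ∀ k, r k ≤ R) (ψ : FockSpace m) {σ : ℝ → ℝ} {τ : ℝ}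
    (h1 : 1 < σ τ) (hσ : HasDerivAt σ (-(R * (σ τ ^ 2 - 1))) τ) {K : ℕ} (hK : 1 ≤ K) :
    ∃ D, HasDerivAt (fun u => cutoffEnergy (σ u) K (U u ψ)) D τ ∧
      D ≤ R * (σ τ - (σ τ)⁻¹) * (m / 2) * cutoffEnergy (σ τ) K (U τ ψ) := by
  have h0 : 0 < σ τ := by linarith
  have hd : 0 ≤ σ τ - (σ τ)⁻¹ := by
    have := inv_lt_one_of_one_lt₀ h1
    linarith
  set F := (finite_totalNumber_le m (K + 1)).toFinset with hF
  set δ := R * (σ τ - (σ τ)⁻¹) with hδ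
  have hδ0 : 0 ≤ δ := mul_nonneg hR0 hd
  have hq : -(R * (σ τ ^ 2 - 1)) / σ τ = -δ := by rw [hδ]; field_simp
  have hpow : HasDerivAt (fun u => σ u ^ K) (-(K * σ τ ^ K * δ)) τ := by
    refine (hσ.pow K).congr_deriv ?_
    obtain ⟨j, rfl⟩ := Nat.exists_eq_add_of_le' hK
    rw [← neg_eq_iff_eq_neg.2 hq]
    simp only [Nat.add_sub_cancel, pow_succ]
    field_simp
  have hw : ∀ n : Fin m → ℕ, HasDerivAt (fun u => cutoffWeight (σ u) K n)
      (-(min (totalNumber n) K * cutoffWeight (σ τ) K n * δ)) τ := fun n => by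
    refine (hasDerivAt_cutoffWeight hσ h0.ne' K n).congr_deriv ?_
    rw [hq]; ring
  set x : (Fin m → ℕ) → ℂ := fun n => U τ ψ n with hx
  set c : (Fin m → ℕ) → ℝ := fun n => cutoffWeight (σ τ) K n - σ τ ^ K with hc
  have hc0 : ∀ n, K ≤ totalNumber n → c n = 0 := fun n hn => by
    simp [hc, cutoffWeight, min_eq_right hn]
  have hterm : ∀ n, HasDerivAt
      (fun u => (cutoffWeight (σ u) K n - σ u ^ K) * ‖U u ψ n‖ ^ 2)
      ((-(min (totalNumber n) K * cutoffWeight (σ τ) K n * δ) + K * σ τ ^ K * δ) * ‖x n‖ ^ 2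
        + c n * (2 * inner ℝ (x n) (∑ q ∈ F, (squeezingMatrix r n q : ℂ) * x q))) τ := by
    intro n
    have ha : HasDerivAt (fun u => cutoffWeight (σ u) K n - σ u ^ K)
        (-(min (totalNumber n) K * cutoffWeight (σ τ) K n * δ) + K * σ τ ^ K * δ) τ :=
      ((hw n).sub hpow).congr_deriv (by ring)
    have hb := (hU.hasDerivAt_apply ψ n (le_max_left (totalNumber n + 2) (K + 1)) τ).norm_sq
    refine (ha.mul hb).congr_deriv ?_
    congr 1
    -- At or above the cutoff the coefficient `c n` is zero, so the range of the inner sum is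
    -- irrelevant. Below it |n| + 2 ≤ K + 1, so the whole matrix row lies in `F`.
    by_cases hn : K ≤ totalNumber n
    · change c n * _ = _
      rw [hc0 n hn]; simp
    · rw [max_eq_right (by omega)]
  refine ⟨_, ((hpow.mul_const (‖ψ‖ ^ 2)).add (HasDerivAt.fun_sum fun n (_ : n ∈ F) =>
    hterm n)).congr_of_eventuallyEq (Eventually.of_forall fun u => ?_), ?_⟩
  · simp [cutoffEnergy, hF]
  have hflux := sum_squeezingMatrix_mul_cutoffWeight_le hr hR0 hR h1 hK x
  have hcw : ∀ p n, cutoffWeight (σ τ) K p - cutoffWeight (σ τ) K n = c p - c n := fun p n => by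
    simp [hc]
  simp_rw [hcw] at hflux
  rw [← sum_mul_inner_antisymm _ (squeezingMatrix_antisymm r), ← hF, ← hδ] at hflux
  rw [Finset.sum_add_distrib, cutoffEnergy_eq, (U τ).norm_map]
  have hT : 0 ≤ ‖ψ‖ ^ 2 - ∑ n ∈ F, ‖x n‖ ^ 2 := by
    have := sum_norm_sq_le F (U τ ψ)
    rw [(U τ).norm_map] at this
    exact sub_nonneg.2 this
  have e1 : ∑ n ∈ F, (-(min (totalNumber n) K * cutoffWeight (σ τ) K n * δ) + K * σ τ ^ K * δ)
      * ‖x n‖ ^ 2 = -(δ * ∑ n ∈ F, min (totalNumber n) K * (cutoffWeight (σ τ) K n * ‖x n‖ ^ 2))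
        + K * σ τ ^ K * δ * ∑ n ∈ F, ‖x n‖ ^ 2 := by
    rw [Finset.mul_sum, Finset.mul_sum, ← Finset.sum_neg_distrib, ← Finset.sum_add_distrib]
    exact Finset.sum_congr rfl fun n _ => by ring
  simp_rw [add_mul, Finset.sum_add_distrib, ← Finset.mul_sum] at hflux
  simp_rw [e1]
  change _ ≤ δ * (m / 2) * ((∑ n ∈ F, cutoffWeight (σ τ) K n * ‖x n‖ ^ 2) + σ τ ^ K *
    (‖ψ‖ ^ 2 - ∑ n ∈ F, ‖x n‖ ^ 2))
  have hm : (0 : ℝ) ≤ m := Nat.cast_nonneg _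
  have hKc : (0 : ℝ) ≤ K := Nat.cast_nonneg _
  -- The mass outside `F` enters the derivative as minus this term and enters the right side as the
  -- term of `h3`, so both signs are favourable.
  have h2 : 0 ≤ K * σ τ ^ K * δ * (‖ψ‖ ^ 2 - ∑ n ∈ F, ‖x n‖ ^ 2) := by positivity
  have h3 : 0 ≤ δ * (m / 2) * (σ τ ^ K * (‖ψ‖ ^ 2 - ∑ n ∈ F, ‖x n‖ ^ 2)) := by positivity
  linarith

/-- The logarithmic derivative of σ^{m/2} is -R(σ - σ⁻¹)m/2, which exactly offsets the remaining
growth rate, so the product has nonpositive derivative. -/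
theorem IsSqueezingGroup.rpow_mul_cutoffEnergy_le {m : ℕ} {r : Fin m → ℝ}
    {U : ℝ → (FockSpace m ≃ₗᵢ[ℂ] FockSpace m)} (hU : IsSqueezingGroup r U) {R : ℝ}
    (hr : ∀ k, 0 ≤ r k) (hR0 : 0 ≤ R) (hR : ∀ k, r k ≤ R) (ψ : FockSpace m) {σ : ℝ → ℝ}
    (h1 : ∀ τ, 0 ≤ τ → 1 < σ τ)
    (hσ : ∀ τ, 0 ≤ τ → HasDerivAt σ (-(R * (σ τ ^ 2 - 1))) τ) {K : ℕ} (hK : 1 ≤ K)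
    {τ : ℝ} (hτ : 0 ≤ τ) :
    σ τ ^ (m / 2 : ℝ) * cutoffEnergy (σ τ) K (U τ ψ)
      ≤ σ 0 ^ (m / 2 : ℝ) * cutoffEnergy (σ 0) K ψ := by
  have hD : ∀ u, 0 ≤ u → ∃ D, HasDerivAt
      (fun u => σ u ^ (m / 2 : ℝ) * cutoffEnergy (σ u) K (U u ψ)) D u ∧ D ≤ 0 := by
    intro u hu
    have h0 : 0 < σ u := by linarith [h1 u hu]
    obtain ⟨D, hD, hle⟩ := hU.exists_hasDerivAt_cutoffEnergy hr hR0 hR ψ (h1 u hu) (hσ u hu) hK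
    refine ⟨_, ((hσ u hu).rpow_const (p := (m / 2 : ℝ)) (Or.inl h0.ne')).mul hD, ?_⟩
    rw [Real.rpow_sub_one h0.ne']
    have hp : 0 < σ u ^ (m / 2 : ℝ) := Real.rpow_pos_of_pos h0 _
    have := mul_le_mul_of_nonneg_left hle hp.le
    have e : -(R * (σ u ^ 2 - 1)) * (m / 2 : ℝ) * (σ u ^ (m / 2 : ℝ) / σ u)
          * cutoffEnergy (σ u) K (U u ψ)
        = -(σ u ^ (m / 2 : ℝ) * (R * (σ u - (σ u)⁻¹) * (m / 2)
          * cutoffEnergy (σ u) K (U u ψ))) := by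
      field_simp
    rw [e]; linarith
  have hanti := antitoneOn_of_deriv_nonpos
    (f := fun u => σ u ^ (m / 2 : ℝ) * cutoffEnergy (σ u) K (U u ψ)) (convex_Ici (0 : ℝ))
    (fun u hu => (hD u hu).choose_spec.1.continuousAt.continuousWithinAt)
    (fun u hu => (hD u (interior_subset hu)).choose_spec.1.differentiableAt.differentiableWithinAt)
    (fun u hu => by
      have := (hD u (interior_subset hu)).choose_spec
      rw [this.1.deriv]; exact this.2)
  have := hanti (Set.mem_Ici.2 le_rfl) (Set.mem_Ici.2 hτ) hτ
  simpa only [hU.zero_apply] using this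

/-! ### Removing the cutoff. -/

theorem expEnergy_mono {m : ℕ} {t u : ℝ} (ht : 0 ≤ t) (htu : t ≤ u) (ψ : FockSpace m) :
    expEnergy t ψ ≤ expEnergy u ψ :=
  ENNReal.tsum_le_tsum fun n => ENNReal.ofReal_le_ofReal (by gcongr)

theorem hasSum_norm_sq {m : ℕ} (ψ : FockSpace m) :
    HasSum (fun n => ‖ψ n‖ ^ 2) (‖ψ‖ ^ 2) := by
  have := lp.hasSum_norm (p := 2) (by norm_num) ψ
  simpa using this

theorem summable_of_expEnergy_lt_top {m : ℕ} {t : ℝ} (ht : 0 ≤ t) {ψ : FockSpace m}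
    (h : expEnergy t ψ < ⊤) : Summable fun n => t ^ totalNumber n * ‖ψ n‖ ^ 2 := by
  have h2 := ENNReal.summable_toReal h.ne
  refine h2.congr fun n => ENNReal.toReal_ofReal (by positivity)

theorem cutoffEnergy_le {m : ℕ} {σ : ℝ} (hσ : 1 ≤ σ) (K : ℕ) {ψ : FockSpace m}
    (h : expEnergy σ ψ < ⊤) :
    cutoffEnergy σ K ψ ≤ ∑' n, σ ^ totalNumber n * ‖ψ n‖ ^ 2 := by
  have h0 : 0 ≤ σ := by linarith
  have hs := summable_of_expEnergy_lt_top h0 h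
  set F := (finite_totalNumber_le m (K + 1)).toFinset with hF
  have h1 := hasSum_norm_sq ψ
  have hsum : HasSum (fun n => σ ^ K * ‖ψ n‖ ^ 2
      + if n ∈ F then (cutoffWeight σ K n - σ ^ K) * ‖ψ n‖ ^ 2 else 0) (cutoffEnergy σ K ψ) := by
    refine (h1.mul_left _).add ?_
    have : HasSum (fun n => if n ∈ F then (cutoffWeight σ K n - σ ^ K) * ‖ψ n‖ ^ 2 else 0) _ :=
      hasSum_sum_of_ne_finset_zero (s := F) fun n hn => if_neg hn
    rwa [Finset.sum_congr rfl fun n hn => if_pos hn] at this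
  refine hasSum_le (fun n => ?_) hsum hs.hasSum
  have hn := sq_nonneg ‖ψ n‖
  split_ifs with hF'
  · rw [← add_mul, add_sub_cancel]
    refine mul_le_mul_of_nonneg_right ?_ hn
    exact pow_le_pow_right₀ hσ (min_le_left _ _)
  · rw [add_zero]
    refine mul_le_mul_of_nonneg_right ?_ hn
    rw [hF, mem_finite_totalNumber_le] at hF'
    exact pow_le_pow_right₀ hσ (by omega)

/-- Any finite partial sum of the energy lies below some cutoff, where the truncated weight is
exact; the tail of the truncated energy is nonnegative. -/
theorem expEnergy_le_of_cutoffEnergy_le {m : ℕ} {σ : ℝ} (hσ : 0 ≤ σ) {C : ℝ} {ψ : FockSpace m}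
    (h : ∀ K, 1 ≤ K → cutoffEnergy σ K ψ ≤ C) : expEnergy σ ψ ≤ ENNReal.ofReal C := by
  rw [expEnergy, ENNReal.tsum_eq_iSup_sum]
  refine iSup_le fun S => ?_
  rw [← ENNReal.ofReal_sum_of_nonneg fun n _ => by positivity]
  refine ENNReal.ofReal_le_ofReal ?_
  -- The added 1 ensures K ≥ 1, also for empty `S`.
  set K := S.sup totalNumber + 1
  refine le_trans ?_ (h K (by omega))
  rw [cutoffEnergy_eq]
  have hS : ∀ n ∈ S, totalNumber n ≤ K := fun n hn =>
    (Finset.le_sup (f := totalNumber) hn).trans (Nat.le_succ _)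
  have h1 : ∑ n ∈ S, σ ^ totalNumber n * ‖ψ n‖ ^ 2 ≤
      ∑ n ∈ (finite_totalNumber_le m (K + 1)).toFinset, cutoffWeight σ K n * ‖ψ n‖ ^ 2 := by
    have : ∑ n ∈ S, σ ^ totalNumber n * ‖ψ n‖ ^ 2 = ∑ n ∈ S, cutoffWeight σ K n * ‖ψ n‖ ^ 2 :=
      Finset.sum_congr rfl fun n hn => by rw [cutoffWeight, min_eq_left (hS n hn)]
    rw [this]
    refine Finset.sum_le_sum_of_subset_of_nonneg (fun n hn => ?_) fun n _ _ => ?_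
    · rw [mem_finite_totalNumber_le]; exact (hS n hn).trans (Nat.le_succ _)
    · rw [cutoffWeight]; positivity
  have h2 := sum_norm_sq_le (finite_totalNumber_le m (K + 1)).toFinset ψ
  have h3 := mul_nonneg (pow_nonneg hσ K) (sub_nonneg.2 h2)
  linarith

/-! ### The Riccati flow and the energy bound at the threshold. -/

theorem isSqueezingGroup_choose {m : ℕ} (r : Fin m → ℝ) :
    IsSqueezingGroup r (exists_isSqueezingGroup r).choose :=
  (exists_isSqueezingGroup r).choose_spec

/-- The solution of `σ' = -R (σ² - 1)` with `σ 0 = s`. -/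
noncomputable def squeezeFlow (R s τ : ℝ) : ℝ :=
  (1 + Real.exp (-(2 * R * τ)) * ((s - 1) / (s + 1))) /
    (1 - Real.exp (-(2 * R * τ)) * ((s - 1) / (s + 1)))

/-- This quantity is x = (σ - 1)/(σ + 1), in which the Riccati equation becomes x' = -2Rx. That x
lies in (0, 1) means that σ is finite and exceeds 1. -/
theorem exp_mul_div_mem_Ioo {R s τ : ℝ} (hR : 0 ≤ R) (hs : 1 < s) (hτ : 0 ≤ τ) :
    0 < Real.exp (-(2 * R * τ)) * ((s - 1) / (s + 1)) ∧
      Real.exp (-(2 * R * τ)) * ((s - 1) / (s + 1)) < 1 := by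
  have h1 : 0 < (s - 1) / (s + 1) := div_pos (by linarith) (by linarith)
  have h2 : (s - 1) / (s + 1) < 1 := by rw [div_lt_one (by linarith)]; linarith
  have h3 : Real.exp (-(2 * R * τ)) ≤ 1 := Real.exp_le_one_iff.2 (by
    have : 0 ≤ 2 * R * τ := by positivity
    linarith)
  exact ⟨mul_pos (Real.exp_pos _) h1, by nlinarith [Real.exp_pos (-(2 * R * τ))]⟩

theorem one_lt_squeezeFlow {R s τ : ℝ} (hR : 0 ≤ R) (hs : 1 < s) (hτ : 0 ≤ τ) :
    1 < squeezeFlow R s τ := by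
  obtain ⟨h1, h2⟩ := exp_mul_div_mem_Ioo hR hs hτ
  rw [squeezeFlow, lt_div_iff₀ (by linarith)]
  linarith

theorem hasDerivAt_squeezeFlow {R s τ : ℝ} (hR : 0 ≤ R) (hs : 1 < s) (hτ : 0 ≤ τ) :
    HasDerivAt (squeezeFlow R s) (-(R * (squeezeFlow R s τ ^ 2 - 1))) τ := by
  obtain ⟨h1, h2⟩ := exp_mul_div_mem_Ioo hR hs hτ
  set x := Real.exp (-(2 * R * τ)) * ((s - 1) / (s + 1)) with hx
  have h3 : HasDerivAt (fun τ => Real.exp (-(2 * R * τ)) * ((s - 1) / (s + 1)))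
      (-(2 * R) * x) τ := by
    have := (((hasDerivAt_id τ).const_mul (2 * R)).neg.exp).mul_const ((s - 1) / (s + 1))
    refine this.congr_deriv ?_
    simp only [hx, id, Pi.neg_apply]; ring
  have h4 : 1 - x ≠ 0 := by linarith
  refine ((h3.const_add 1).div (h3.const_sub 1) h4).congr_deriv ?_
  rw [squeezeFlow, ← hx]
  field_simp
  ring

theorem squeezeFlow_zero (R : ℝ) {s : ℝ} (hs : 1 < s) : squeezeFlow R s 0 = s := by
  have : s + 1 ≠ 0 := by linarith
  simp only [squeezeFlow, mul_zero, neg_zero, Real.exp_zero, one_mul]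
  field_simp
  ring

/-- This is where f comes from: in terms of e^R, its denominator is (e^{2R}(s + 1) - (s - 1))/2. -/
theorem squeezeFlow_one {R s : ℝ} (hR : 0 ≤ R) (hs : 1 < s) :
    squeezeFlow R s 1 = squeezeThreshold R s := by
  obtain ⟨h1, h2⟩ := exp_mul_div_mem_Ioo hR hs zero_le_one
  have hsh := Real.sinh_nonneg_iff.2 hR
  have hA : 0 < Real.exp (2 * R) + Real.sinh R * Real.exp R * (s - 1) := by
    have : 0 ≤ s - 1 := by linarith
    positivity
  have hs1 : s + 1 ≠ 0 := by linarith
  rw [squeezeFlow, squeezeThreshold, div_eq_iff (by linarith), mul_one]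
  have hE := Real.exp_pos R
  have hD : Real.exp (2 * R) + Real.sinh R * Real.exp R * (s - 1)
      = (Real.exp R ^ 2 * (s + 1) - (s - 1)) / 2 := by
    rw [Real.sinh_eq, two_mul, Real.exp_add, Real.exp_neg]
    field_simp
    ring
  rw [hD] at hA ⊢
  have e : Real.exp (-(2 * R)) = (Real.exp R ^ 2)⁻¹ := by
    rw [Real.exp_neg, two_mul, Real.exp_add, sq]
  rw [e]
  have hA' : Real.exp R ^ 2 * (s + 1) - (s - 1) ≠ 0 := by linarith
  field_simp
  ring

/-- The core estimate, holding for every s > 1. The restriction s < 1/tanh R serves only the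
comparison with the stated constants. -/
theorem expEnergy_squeezing_threshold_le {m : ℕ} {r : Fin m → ℝ} {R s : ℝ} (hr : ∀ k, 0 ≤ r k)
    (hR0 : 0 ≤ R) (hR : ∀ k, r k ≤ R) (hs : 1 < s) (ψ : FockSpace m) (hE : expEnergy s ψ < ⊤) :
    expEnergy (squeezeThreshold R s) (squeezing r ψ)
      ≤ ENNReal.ofReal ((s / squeezeThreshold R s) ^ (m / 2 : ℝ)) * expEnergy s ψ := by
  have hf : 1 < squeezeThreshold R s := by
    rw [← squeezeFlow_one hR0 hs]; exact one_lt_squeezeFlow hR0 hs zero_le_one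
  have hf0 : 0 < squeezeThreshold R s := by linarith
  have hs0 : 0 < s := by linarith
  have hE' : expEnergy s ψ = ENNReal.ofReal (∑' n, s ^ totalNumber n * ‖ψ n‖ ^ 2) := by
    rw [ENNReal.ofReal_tsum_of_nonneg (fun n => by positivity)
      (summable_of_expEnergy_lt_top hs0.le hE)]
    rfl
  rw [hE', ← ENNReal.ofReal_mul (by positivity)]
  refine expEnergy_le_of_cutoffEnergy_le hf0.le fun K hK => ?_
  have h := (isSqueezingGroup_choose r).rpow_mul_cutoffEnergy_le hr hR0 hR ψ
    (fun τ => one_lt_squeezeFlow hR0 hs) (fun τ => hasDerivAt_squeezeFlow hR0 hs) hK zero_le_one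
  rw [squeezeFlow_zero R hs, squeezeFlow_one hR0 hs] at h
  have h2 := h.trans (mul_le_mul_of_nonneg_left (cutoffEnergy_le hs.le K hE) (by positivity))
  rw [Real.div_rpow hs0.le hf0.le, div_mul_eq_mul_div, le_div_iff₀' (by positivity)]
  exact h2

theorem expEnergy_pos {m : ℕ} {t : ℝ} (ht : 0 < t) {ψ : FockSpace m} (hψ : ψ ≠ 0) :
    0 < expEnergy t ψ := by
  obtain ⟨n, hn⟩ : ∃ n, ψ n ≠ 0 := by
    by_contra! h
    exact hψ (lp.ext (funext h))
  refine lt_of_lt_of_le ?_ (ENNReal.le_tsum n)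
  rw [ENNReal.ofReal_pos]
  have := norm_pos_iff.2 hn
  positivity

/-- Strictness comes from the constants alone: the m-th power preserves it as m ≥ 1, and
multiplication by the energy does because that is neither 0 nor ∞. -/
theorem expEnergy_squeezing_lt {m : ℕ} [NeZero m] {r : Fin m → ℝ} {R s t : ℝ} (hr : ∀ k, 0 ≤ r k)
    (hR0 : 0 ≤ R) (hR : ∀ k, r k ≤ R) (hs : 1 < s) (ht : 0 ≤ t) (htf : t ≤ squeezeThreshold R s)
    {ψ : FockSpace m} (hψ : ψ ≠ 0) (hE : expEnergy s ψ < ⊤) {C : ℝ}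
    (hC : √(s / squeezeThreshold R s) < C) :
    expEnergy t (squeezing r ψ) < ENNReal.ofReal (C ^ m) * expEnergy s ψ := by
  refine ((expEnergy_mono ht htf _).trans
    (expEnergy_squeezing_threshold_le hr hR0 hR hs ψ hE)).trans_lt ?_
  have hf : 1 < squeezeThreshold R s := by
    rw [← squeezeFlow_one hR0 hs]; exact one_lt_squeezeFlow hR0 hs zero_le_one
  have h0 : 0 ≤ s / squeezeThreshold R s := by positivity
  refine ENNReal.mul_lt_mul_left (expEnergy_pos (by linarith) hψ).ne' hE.ne ?_
  have e : (s / squeezeThreshold R s) ^ (m / 2 : ℝ) = √(s / squeezeThreshold R s) ^ m := by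
    rw [Real.sqrt_eq_rpow, ← Real.rpow_natCast, ← Real.rpow_mul h0]
    congr 1; ring
  have hC0 : 0 < C := (Real.sqrt_nonneg _).trans_lt hC
  rw [e, ENNReal.ofReal_lt_ofReal_iff (by positivity)]
  exact pow_lt_pow_left₀ hC (Real.sqrt_nonneg _) (NeZero.ne m)

/-! ### Scalar comparison of the constants. -/

/-- If `s < 1 / tanh R` then `sinh R (s - 1) < e^{-R}`. -/
theorem sinh_mul_lt_exp_neg {R s : ℝ} (hR : 0 < R) (hs : s < 1 / Real.tanh R) :
    Real.sinh R * (s - 1) < Real.exp (-R) := by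
  have hsh := Real.sinh_pos_iff.2 hR
  rw [Real.tanh_eq_sinh_div_cosh, one_div_div, lt_div_iff₀ hsh] at hs
  have := Real.cosh_sub_sinh R
  linarith

/-- At R = 0 the convention 1/0 = 0 turns the bound into s < 0. Part (1) loses nothing by this,
since f(0, s) = s already contradicts f < s. -/
theorem pos_of_lt_one_div_tanh {R s : ℝ} (hR : 0 ≤ R) (h1 : 1 < s) (hs : s < 1 / Real.tanh R) :
    0 < R := by
  rcases hR.eq_or_lt with rfl | h
  · simp at hs; linarith
  · exact h

/-- Only A > 1 and 0 < B ≤ 1 are needed. Dropping (t - 1)A from the denominator gives the strict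
inequality, and what remains is B(s - 1)² ≤ s(A + s - 1). The bound on s enters through B =
e^{-R}(e^{-R} - sinh R (s - 1)) > 0. -/
theorem sqrt_div_threshold_lt_squeezeFactor {R s t : ℝ} (hR : 0 < R) (ht : 1 < t)
    (hs : 1 < s) (htf : t < squeezeThreshold R s) (hsR : s < 1 / Real.tanh R) :
    √(s / squeezeThreshold R s) < squeezeFactor R s t := by
  have hsh := Real.sinh_pos_iff.2 hR
  have hlt := sinh_mul_lt_exp_neg hR hsR
  have hu : 0 < s - 1 := by linarith
  rw [squeezeFactor]
  rw [squeezeThreshold] at htf ⊢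
  set A := Real.exp (2 * R) + Real.sinh R * Real.exp R * (s - 1) with hA
  set B := Real.exp (-2 * R) - Real.sinh R * Real.exp (-R) * (s - 1) with hB
  have hA1 : 1 < A := by
    have h1 : 1 < Real.exp (2 * R) := Real.one_lt_exp_iff.2 (by linarith)
    have h2 : 0 < Real.sinh R * Real.exp R * (s - 1) := by positivity
    linarith
  have hB0 : 0 < B := by
    have e : B = Real.exp (-R) * (Real.exp (-R) - Real.sinh R * (s - 1)) := by
      rw [hB, show -2 * R = -R + -R by ring, Real.exp_add]; ring
    rw [e]
    exact mul_pos (Real.exp_pos _) (by linarith)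
  have hB1 : B ≤ 1 := by
    have h1 : Real.exp (-2 * R) ≤ 1 := Real.exp_le_one_iff.2 (by linarith)
    have h2 : 0 < Real.sinh R * Real.exp (-R) * (s - 1) := by positivity
    linarith
  have hA0 : 0 < A := by linarith
  have hden : 0 < (s - 1) - (t - 1) * A := by
    have : t - 1 < (s - 1) / A := by linarith
    rw [lt_div_iff₀ hA0] at this
    linarith
  have hden' : (s - 1) - (t - 1) * A < s - 1 := by
    have : 0 < (t - 1) * A := mul_pos (by linarith) hA0
    linarith
  have hAB : 0 < √(A / B) := Real.sqrt_pos.2 (by positivity)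
  have hlt2 : s * √(A / B) * (1 / (s - 1)) < s * √(A / B) * (1 / ((s - 1) - (t - 1) * A)) :=
    mul_lt_mul_of_pos_left (one_div_lt_one_div_of_lt hden hden') (by positivity)
  refine lt_of_le_of_lt (Real.sqrt_le_iff.2 ⟨by positivity, ?_⟩) hlt2
  rw [mul_pow, mul_pow, Real.sq_sqrt (by positivity)]
  have e1 : s / (1 + (s - 1) / A) = s * A / (A + (s - 1)) := by field_simp
  have e2 : s ^ 2 * (A / B) * (1 / (s - 1)) ^ 2 = s ^ 2 * A / (B * (s - 1) ^ 2) := by field_simp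
  rw [e1, e2, div_le_div_iff₀ (by positivity) (by positivity)]
  have h3 : B * (s - 1) ^ 2 ≤ s * (A + (s - 1)) := by nlinarith [sq_nonneg (s - 1)]
  have h4 : 0 < s * A := by positivity
  nlinarith [mul_le_mul_of_nonneg_left h3 h4.le]

/-- Multiplying sinh R (s - 1) < e^{-R} by e^R bounds the second term in the denominator of f by 1.
-/
theorem lt_squeezeThreshold {R s : ℝ} (hR : 0 < R) (hs : 1 < s) (hsR : s < 1 / Real.tanh R) :
    1 + (s - 1) / (Real.exp (2 * R) + 1) < squeezeThreshold R s := by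
  have hsh := Real.sinh_pos_iff.2 hR
  have hu : 0 < s - 1 := by linarith
  have h2 := mul_lt_mul_of_pos_left (sinh_mul_lt_exp_neg hR hsR) (Real.exp_pos R)
  rw [← Real.exp_add, add_neg_cancel, Real.exp_zero] at h2
  rw [squeezeThreshold]
  have h3 : 0 < Real.sinh R * Real.exp R * (s - 1) := by positivity
  gcongr
  linarith

theorem squeezeThreshold_lt {R s : ℝ} (hR : 0 < R) (hs : 1 < s) : squeezeThreshold R s < s := by
  have hsh := Real.sinh_pos_iff.2 hR
  have hu : 0 < s - 1 := by linarith
  have h1 : 1 < Real.exp (2 * R) := Real.one_lt_exp_iff.2 (by linarith)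
  have h2 : 0 < Real.sinh R * Real.exp R * (s - 1) := by positivity
  have := div_lt_self hu
    (by linarith : 1 < Real.exp (2 * R) + Real.sinh R * Real.exp R * (s - 1))
  rw [squeezeThreshold]
  linarith

/-- The constant is reached directly, without passing through g: f is replaced by the smaller 1 + (s
- 1)/P, and 0 < D ≤ 1 < P gives P ≤ P²/D², so that the bound sP/(s - 1) suffices. -/
theorem sqrt_div_threshold_lt {R s : ℝ} (hR : 0 < R) (hs : 1 < s) (hsR : s < 1 / Real.tanh R) :
    √(s / squeezeThreshold R s) < s / (s - 1) * ((Real.exp (2 * R) + 1) ^ 2 /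
      (Real.exp (-R) - Real.sinh R * (s - 1)) ^ 2) := by
  have hsh := Real.sinh_pos_iff.2 hR
  have hlt := sinh_mul_lt_exp_neg hR hsR
  have hu : 0 < s - 1 := by linarith
  have hf := lt_squeezeThreshold hR hs hsR
  set P := Real.exp (2 * R) + 1 with hP
  set D := Real.exp (-R) - Real.sinh R * (s - 1) with hD
  have hP1 : 1 < P := by have := Real.exp_pos (2 * R); linarith
  have hD0 : 0 < D := by linarith
  have hD1 : D ≤ 1 := by
    have h1 : Real.exp (-R) ≤ 1 := Real.exp_le_one_iff.2 (by linarith)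
    have h2 : 0 < Real.sinh R * (s - 1) := by positivity
    linarith
  have hPD : P ≤ P ^ 2 / D ^ 2 := by
    rw [le_div_iff₀ (by positivity)]
    have : D ^ 2 ≤ 1 := pow_le_one₀ hD0.le hD1
    nlinarith
  have hf0 : 0 < 1 + (s - 1) / P := by positivity
  have h1 : √(s / squeezeThreshold R s) < √(s / (1 + (s - 1) / P)) :=
    Real.sqrt_lt_sqrt (div_nonneg (by linarith) (by linarith))
      (div_lt_div_of_pos_left (by linarith) hf0 hf)
  refine h1.trans_le ((Real.sqrt_le_iff.2 ⟨by positivity, ?_⟩).trans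
    (mul_le_mul_of_nonneg_left hPD (by positivity)))
  have e1 : s / (1 + (s - 1) / P) = s * P / (P + (s - 1)) := by field_simp
  have e2 : (s / (s - 1) * P) ^ 2 = (s * P) ^ 2 / (s - 1) ^ 2 := by field_simp
  rw [e1, e2, div_le_div_iff₀ (by positivity) (by positivity)]
  have h3 : (s - 1) ^ 2 ≤ s * P * (P + (s - 1)) := by
    have : s ≤ s * P := le_mul_of_one_le_right (by linarith) hP1.le
    nlinarith
  have h4 : 0 < s * P := by positivity
  nlinarith [mul_le_mul_of_nonneg_left h3 h4.le]

end Bosonic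

/-! ### The two bounds of the lemma. -/

theorem mainTheorem7 {m : ℕ} [NeZero m] (r : Fin m → ℝ) (hr : ∀ i, 0 ≤ r i)
    (R : ℝ) (hR : R = Finset.univ.sup' Finset.univ_nonempty r) (s : ℝ)
    (ψ : Bosonic.FockSpace m) (hψ : ‖ψ‖ = 1) (hE : Bosonic.expEnergy s ψ < ⊤) :
    (∀ t : ℝ, 1 < t → t < Bosonic.squeezeThreshold R s → Bosonic.squeezeThreshold R s < s →
      s < 1 / Real.tanh R →
      Bosonic.expEnergy t (Bosonic.squeezing r ψ)
        < ENNReal.ofReal (Bosonic.squeezeFactor R s t ^ m) * Bosonic.expEnergy s ψ) ∧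
    (∀ t : ℝ, 1 < s → s < 1 / Real.tanh R → t = 1 + (s - 1) / (Real.exp (2 * R) + 1) →
      1 < t ∧ t < Bosonic.squeezeThreshold R s ∧ Bosonic.squeezeThreshold R s < s ∧
      Bosonic.expEnergy t (Bosonic.squeezing r ψ)
        < ENNReal.ofReal ((s / (s - 1) * ((Real.exp (2 * R) + 1) ^ 2 /
            (Real.exp (-R) - Real.sinh R * (s - 1)) ^ 2)) ^ m) * Bosonic.expEnergy s ψ) := by
  have hle : ∀ k, r k ≤ R := fun k => by rw [hR]; exact Finset.le_sup' r (Finset.mem_univ k)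
  have hR0 : 0 ≤ R := (hr 0).trans (hle 0)
  have hψ0 : ψ ≠ 0 := by rintro rfl; simp at hψ
  refine ⟨fun t ht htf hfs hsR => ?_, fun t hs hsR ht => ?_⟩
  · have hs : 1 < s := ht.trans (htf.trans hfs)
    exact Bosonic.expEnergy_squeezing_lt hr hR0 hle hs (by linarith) htf.le hψ0 hE
      (Bosonic.sqrt_div_threshold_lt_squeezeFactor (Bosonic.pos_of_lt_one_div_tanh hR0 hs hsR) ht hs
        htf hsR)
  · have hRpos := Bosonic.pos_of_lt_one_div_tanh hR0 hs hsR
    have hu : 0 < s - 1 := by linarith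
    have ht1 : 1 < t := by
      have : 0 < (s - 1) / (Real.exp (2 * R) + 1) := by positivity
      linarith
    have htf : t < Bosonic.squeezeThreshold R s :=
      ht ▸ Bosonic.lt_squeezeThreshold hRpos hs hsR
    exact ⟨ht1, htf, Bosonic.squeezeThreshold_lt hRpos hs,
      Bosonic.expEnergy_squeezing_lt hr hR0 hle hs (by linarith) htf.le hψ0 hE
        (Bosonic.sqrt_div_threshold_lt hRpos hs hsR)⟩
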